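/- Let $S\subset S^{n-1}\subset\mathbb R^n$ be a finite set of unit vectors with $S=-S$ (a configuration), and put $P_{\mathbf x}(\mathbf y)=\langle \mathbf y,\mathbf x\rangle\mathbf x$. $S$ is perfect if the maps $P_{\mathbf x}$, $\mathbf x\in S$, span the space of symmetric linear maps $\mathbb R^n\to\mathbb R^n$. $S$ is eutactic (resp. semi-eutactic) if there are positive (resp. non-negative) numbers $\upsilon_{\mathbf x}=\upsilon_{-\mathbf x}$, $\mathbf x\in S$, with $\mathrm{Id}=\sum_{\mathbf x\in S}\upsilon_{\mathbf x}P_{\mathbf x}$. $S$ is extreme if it is perfect and eutactic; it is minimally extreme if it is extreme and $|S|=n(n+1)$; it is redundantly semi-eutactic (resp. redundantly extreme) if it is extreme and $S\setminus\{\mathbf x,-\mathbf x\}$ is semi-eutactic (resp. extreme) for every $\mathbf x\in S$. A lattice $\Lambda\subset\mathbb R^n$ is said to have one of these properties if the set of its nonzero vectors of minimal norm, scaled to unit length, has it. For a simply laced Dynkin diagram with $n$ nodes, the corresponding root lattice is the lattice in $\mathbb R^n$, unique up to an orthogonal transformation, generated over $\mathbb Z$ by vectors $\mathbf a_1,\dots,\mathbf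 a_n$ with $\langle\mathbf a_i,\mathbf a_i\rangle=1$, $\langle\mathbf a_i,\mathbf a_j\rangle=-\tfrac12$ if the distinct nodes $i,j$ are joined by an edge, and $\langle\mathbf a_i,\mathbf a_j\rangle=0$ otherwise. The Leech lattice is $\Lambda_{24}=L\cup(L+\mathbf x)$, where $$L=\Bigl\{2^{-3/2}\mathbf z:\ \mathbf z\in\mathbb Z^{24},\ \sum_{i=1}^{24}z_i\in4\mathbb Z,\ \mathbf z \bmod 2\in\mathcal C\Bigr\},\qquad \mathbf x=2^{-5/2}(-3,1,1,\dots,1),$$ and $\mathcal C\subset\mathbb F_2^{24}$ is the extended binary Golay code (the cyclic code of length $23$ generated by $1+X^2+X^4+X^5+X^6+X^{10}+X^{11}$, extended by a parity bit). Then: (1) for every $n\ge2$, the root lattice $A_n$ is minimally extreme; (2) for every $n\ge4$, the root lattice $D_n$ is redundantly semi-eutactic but not redundantly extreme; (3) the root lattices $E_6$, $E_7$, $E_8$ and the Leech lattice $\Lambda_{24}$ are redundantly extreme. -/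

import Mathlib

open scoped RealInnerProductSpace

noncomputable section

namespace PerfectEutactic

section Configurations

variable {E : Type*} [NormedAddCommGroup E] [InnerProductSpace ℝ E]

/-- The rank-one map `P_x(y) = ⟨y, x⟩ x`. -/
def proj (x : E) : E →ₗ[ℝ] E where
  toFun y := ⟪y, x⟫ • x
  map_add' y z := by rw [inner_add_left, add_smul]
  map_smul' c y := by simp [real_inner_smul_left, mul_smul]

/-- A finite, origin-symmetric set of unit vectors. -/
structure IsConfiguration (S : Set E) : Prop where
  finite : S.Finite
  norm_eq_one : ∀ x ∈ S, ‖x‖ = 1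
  neg_mem : ∀ x ∈ S, -x ∈ S

/-- The maps `P_x`, `x ∈ S`, span the space of symmetric linear maps. -/
def IsPerfect (S : Set E) : Prop :=
  IsConfiguration S ∧
    ∀ Q : E →ₗ[ℝ] E, Q ∈ Submodule.span ℝ (proj '' S) ↔ Q.IsSymmetric

/-- `v` is a family of eutaxy coefficients for `S` (values outside `S` are irrelevant). -/
def IsEutaxyCoeff (S : Set E) (v : E → ℝ) : Prop :=
  (∀ x ∈ S, v x = v (-x)) ∧ (LinearMap.id : E →ₗ[ℝ] E) = ∑ᶠ x ∈ S, v x • proj x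

def IsEutactic (S : Set E) : Prop :=
  IsConfiguration S ∧ ∃ v : E → ℝ, IsEutaxyCoeff S v ∧ ∀ x ∈ S, 0 < v x

def IsSemiEutactic (S : Set E) : Prop :=
  IsConfiguration S ∧ ∃ v : E → ℝ, IsEutaxyCoeff S v ∧ ∀ x ∈ S, 0 ≤ v x

def IsExtreme (S : Set E) : Prop :=
  IsPerfect S ∧ IsEutactic S

def IsRedundantlySemiEutactic (S : Set E) : Prop :=
  IsExtreme S ∧ ∀ x ∈ S, IsSemiEutactic (S \ {x, -x})

def IsRedundantlyExtreme (S : Set E) : Prop :=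
  IsExtreme S ∧ ∀ x ∈ S, IsExtreme (S \ {x, -x})

/-- Extreme, with exactly `n (n + 1)` vectors, where `n` is the dimension of the space. -/
def IsMinimallyExtreme (S : Set E) : Prop :=
  IsExtreme S ∧ S.ncard = Module.finrank ℝ E * (Module.finrank ℝ E + 1)

/-- The nonzero vectors of `Λ` of least norm. -/
def minimalVectors (Λ : Submodule ℤ E) : Set E :=
  {x | x ∈ Λ ∧ x ≠ 0 ∧ ∀ y ∈ Λ, y ≠ 0 → ⟪x, x⟫ ≤ ⟪y, y⟫}

/-- The minimal vectors of `Λ`, scaled to lie on the unit sphere. -/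
def minimalConfiguration (Λ : Submodule ℤ E) : Set E :=
  (fun x : E => ‖x‖⁻¹ • x) '' minimalVectors Λ

end Configurations

/-- `Λ` is (a copy of) the root lattice in `ℝⁿ` whose simply laced Cartan matrix is `C`: it is
generated over `ℤ` by vectors `a₁, …, aₙ` with `⟨aᵢ, aⱼ⟩ = Cᵢⱼ / 2`, i.e. `1` if `i = j`, `-1/2` if
`i`, `j` are joined in the Dynkin diagram, and `0` otherwise. -/
def IsRootLattice {n : ℕ} (C : Matrix (Fin n) (Fin n) ℤ)
    (Λ : Submodule ℤ (EuclideanSpace ℝ (Fin n))) : Prop :=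
  ∃ a : Fin n → EuclideanSpace ℝ (Fin n),
    (∀ i j, ⟪a i, a j⟫ = (C i j : ℝ) / 2) ∧ Λ = Submodule.span ℤ (Set.range a)

/-- The `j`-th row of the generator matrix of the extended binary Golay code: the coefficients of
`X ^ j * (1 + X² + X⁴ + X⁵ + X⁶ + X¹⁰ + X¹¹)` in positions `0, …, 22`, and a parity bit
(equal to `1`) in position `23`. -/
def golayRow (j : Fin 12) : Fin 24 → ZMod 2 := fun k =>
  if k.val = 23 ∨ k.val ∈ ({0, 2, 4, 5, 6, 10, 11} : Finset ℕ).image (j.val + ·) then 1 else 0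

/-- The extended binary Golay code. -/
def golayCode : Submodule (ZMod 2) (Fin 24 → ZMod 2) :=
  Submodule.span (ZMod 2) (Set.range golayRow)

/-- `L = {2^(-3/2) z : z ∈ ℤ²⁴, ∑ zᵢ ∈ 4ℤ, z mod 2 ∈ golayCode}`. -/
def leechEven : Set (EuclideanSpace ℝ (Fin 24)) :=
  {w | ∃ z : Fin 24 → ℤ, 4 ∣ ∑ i, z i ∧ (∃ c ∈ golayCode, ∀ i, (z i : ZMod 2) = c i) ∧
    w = WithLp.toLp 2 fun i => (2 : ℝ) ^ (-(3 / 2) : ℝ) * (z i : ℝ)}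

/-- `2^(-5/2) (-3, 1, 1, …, 1)`. -/
def leechShift : EuclideanSpace ℝ (Fin 24) :=
  WithLp.toLp 2 fun i => (2 : ℝ) ^ (-(5 / 2) : ℝ) * (if i = 0 then -3 else 1)

theorem leechEven_zero : (0 : EuclideanSpace ℝ (Fin 24)) ∈ leechEven :=
  ⟨0, by simp, ⟨0, golayCode.zero_mem, by simp⟩, by ext i; simp⟩

theorem leechEven_add {v w : EuclideanSpace ℝ (Fin 24)} (hv : v ∈ leechEven)
    (hw : w ∈ leechEven) : v + w ∈ leechEven := by
  obtain ⟨z, hz, ⟨c, hc, hzc⟩, rfl⟩ := hv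
  obtain ⟨z', hz', ⟨c', hc', hzc'⟩, rfl⟩ := hw
  refine ⟨z + z', ?_, ⟨c + c', golayCode.add_mem hc hc', fun i => by simp [hzc, hzc']⟩, ?_⟩
  · simpa [Finset.sum_add_distrib] using dvd_add hz hz'
  · ext i; simp [mul_add]

theorem leechEven_neg {v : EuclideanSpace ℝ (Fin 24)} (hv : v ∈ leechEven) :
    -v ∈ leechEven := by
  obtain ⟨z, hz, ⟨c, hc, hzc⟩, rfl⟩ := hv
  refine ⟨-z, ?_, ⟨-c, golayCode.neg_mem hc, fun i => by simp [hzc]⟩, ?_⟩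
  · simpa using hz
  · ext i; simp

theorem golay_ones : (1 : Fin 24 → ZMod 2) ∈ golayCode := by
  have h : (1 : Fin 24 → ZMod 2) = ∑ j ∈ ({0, 1, 5, 6, 7, 9, 11} : Finset (Fin 12)), golayRow j := by
    decide +kernel
  rw [h]
  exact Submodule.sum_mem _ fun j _ => Submodule.subset_span ⟨j, rfl⟩

theorem leechShift_add_self : leechShift + leechShift ∈ leechEven := by
  refine ⟨fun i => if i = 0 then -3 else 1, by decide, ⟨1, golay_ones, ?_⟩, ?_⟩
  · intro i; by_cases h : i = 0 <;> simp [h]; decide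
  · have h2 : (2 : ℝ) ^ (-(3 / 2) : ℝ) = 2 * (2 : ℝ) ^ (-(5 / 2) : ℝ) := by
      rw [← Real.rpow_one_add' (by norm_num) (by norm_num)]; norm_num
    ext i
    by_cases h : i = 0 <;> simp [leechShift, h, h2] <;> ring

/-- The Leech lattice `L ∪ (L + x)`, with `L = leechEven` and `x = leechShift`. -/
def leechLattice : Submodule ℤ (EuclideanSpace ℝ (Fin 24)) :=
  AddSubgroup.toIntSubmodule
    { carrier := leechEven ∪ (fun w => w + leechShift) '' leechEven
      zero_mem' := Or.inl leechEven_zero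
      add_mem' := by
        rintro _ _ (hv | ⟨v, hv, rfl⟩) (hw | ⟨w, hw, rfl⟩)
        · exact Or.inl (leechEven_add hv hw)
        · exact Or.inr ⟨_, leechEven_add hv hw, by simp only; abel⟩
        · exact Or.inr ⟨_, leechEven_add hv hw, by simp only; abel⟩
        · refine Or.inl ?_
          have h := leechEven_add (leechEven_add hv hw) leechShift_add_self
          convert h using 1
          simp only; abel
      neg_mem' := by
        rintro _ (hv | ⟨v, hv, rfl⟩)
        · exact Or.inl (leechEven_neg hv)
        · refine Or.inr ⟨_, leechEven_neg (leechEven_add hv leechShift_add_self), ?_⟩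
          simp only; abel }

end PerfectEutactic

end

open PerfectEutactic

/-! A configuration is semi-eutactic when `Id` lies in the cone spanned by the maps `P_x`, and a
perfect configuration is extreme when moreover `Id` can absorb a small multiple of each `P_x`.

In a lattice with half-integral inner products the reflections in unit vectors permute the unit
vectors. Polarisation along a connected Dynkin diagram then yields perfection, and, `∑ P_x` being
invariant under these reflections, `∑ P_x` is a multiple of `Id`.

If `f` is an orthonormal quadruple of unit vectors of `Λ` whose half-sum `h` lies in `Λ`, the
vectors `f i - h` form an orthonormal quadruple with the same `∑ P`. Trading `f` for this quadruple
removes `f 0` from a representation of `Id`: hence the redundant semi-eutaxy of `D_n`. Two such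
quadruples which meet only in `±f 0` leave a positive weight on every other vector, so the
configuration without `±f 0` remains extreme. Pairs of quadruples are exhibited for one root of each
of `E₆`, `E₇`, `E₈` and transported by the reflections; in the Leech lattice one starts from `D_24`,
spanned by multiples of the coordinate vectors, and obtains the quadruples from the octads of the
Golay code; a minimal vector outside `D_24` can be removed without touching `D_24`.

In `D_n`, removing `±(e_i + e_j)` leaves `±(e_i - e_j)` as the only roots with a non-zero `(i, j)`
entry of `P`, so their weight must vanish. -/

open scoped RealInnerProductSpace

namespace PerfectEutactic

section SymmetricMaps

variable {E : Type*} [NormedAddCommGroup E] [InnerProductSpace ℝ E]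

theorem proj_apply (x y : E) : proj x y = ⟪y, x⟫ • x := rfl

@[simp]
theorem proj_neg (x : E) : proj (-x) = proj x := by
  ext y; simp [proj_apply]

theorem proj_smul (c : ℝ) (x : E) : proj (c • x) = c ^ 2 • proj x := by
  ext y; simp only [proj_apply, LinearMap.smul_apply, real_inner_smul_right]; module

theorem isSymmetric_proj (x : E) : (proj x).IsSymmetric := fun y z => by
  simp only [proj_apply, real_inner_smul_left, real_inner_smul_right]
  rw [real_inner_comm x z, mul_comm]

theorem proj_mem_span {S : Set E} {x : E} (hx : x ∈ S) : proj x ∈ Submodule.span ℝ (proj '' S) :=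
  Submodule.subset_span ⟨x, hx, rfl⟩

theorem isSymmetric_of_mem_span_proj {S : Set E} {Q : E →ₗ[ℝ] E}
    (hQ : Q ∈ Submodule.span ℝ (proj '' S)) : Q.IsSymmetric := by
  induction hQ using Submodule.span_induction with
  | mem P hP => obtain ⟨x, -, rfl⟩ := hP; exact isSymmetric_proj x
  | zero => exact LinearMap.IsSymmetric.zero
  | add P Q _ _ hP hQ => exact hP.add hQ
  | smul a P _ hP => exact hP.smul (by simp)

theorem eq_sum_eigenvalues_smul_proj [FiniteDimensional ℝ E] {Q : E →ₗ[ℝ] E}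
    (hQ : Q.IsSymmetric) :
    Q = ∑ i, hQ.eigenvalues rfl i • proj (hQ.eigenvectorBasis rfl i) := by
  let e := hQ.eigenvectorBasis rfl
  ext y
  calc Q y = ∑ i, ⟪e i, y⟫ • Q (e i) := by
        conv_lhs => rw [← e.sum_repr' y, map_sum]
        simp only [map_smul]
    _ = (∑ i, hQ.eigenvalues rfl i • proj (e i)) y := by
        simp only [LinearMap.sum_apply, LinearMap.smul_apply, proj_apply]
        refine Finset.sum_congr rfl fun i _ => ?_
        rw [hQ.apply_eigenvectorBasis, real_inner_comm]
        exact smul_comm _ _ _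

theorem IsConfiguration.isPerfect [FiniteDimensional ℝ E] {S : Set E} (hS : IsConfiguration S)
    (h : ∀ x, proj x ∈ Submodule.span ℝ (proj '' S)) : IsPerfect S := by
  refine ⟨hS, fun Q => ⟨isSymmetric_of_mem_span_proj, fun hQ => ?_⟩⟩
  rw [eq_sum_eigenvalues_smul_proj hQ]
  exact sum_mem fun i _ => Submodule.smul_mem _ _ (h _)

/-- The symmetrised rank-two map `y ↦ ⟨y, a⟩ b + ⟨y, b⟩ a`, bilinear in `a` and `b`: it polarises
`2 P_x`. -/
noncomputable def symmProd : E →ₗ[ℝ] E →ₗ[ℝ] E →ₗ[ℝ] E :=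
  LinearMap.mk₂ ℝ
    (fun a b =>
      { toFun := fun y => ⟪y, a⟫ • b + ⟪y, b⟫ • a
        map_add' := fun y z => by simp only [inner_add_left]; module
        map_smul' := fun c y => by simp only [real_inner_smul_left, RingHom.id_apply]; module })
    (fun a a' b => by ext y; simp [inner_add_right]; module)
    (fun c a b => by ext y; simp [real_inner_smul_right]; module)
    (fun a b b' => by ext y; simp [inner_add_right]; module)
    (fun c a b => by ext y; simp [real_inner_smul_right]; module)

theorem symmProd_apply (a b y : E) : symmProd a b y = ⟪y, a⟫ • b + ⟪y, b⟫ • a := rfl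

theorem symmProd_self (a : E) : symmProd a a = (2 : ℝ) • proj a := by
  ext y; simp only [symmProd_apply, proj_apply, LinearMap.smul_apply]; module

theorem symmProd_comm (a b : E) : symmProd a b = symmProd b a := by
  ext y; simp only [symmProd_apply, add_comm]

theorem proj_add (a b : E) : proj (a + b) = proj a + proj b + symmProd a b := by
  ext y; simp only [symmProd_apply, proj_apply, LinearMap.add_apply, inner_add_right]; module

theorem proj_sub (a b : E) : proj (a - b) = proj a + proj b - symmProd a b := by
  rw [sub_eq_add_neg, proj_add, proj_neg, map_neg, ← sub_eq_add_neg]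

theorem symmProd_mem_of_span_eq_top {ι : Type*} {p : ι → E}
    (hp : Submodule.span ℝ (Set.range p) = ⊤) {W : Submodule ℝ (E →ₗ[ℝ] E)}
    (h : ∀ i j, symmProd (p i) (p j) ∈ W) (a b : E) : symmProd a b ∈ W := by
  have extend : ∀ c, (∀ i, symmProd c (p i) ∈ W) → ∀ d, symmProd c d ∈ W := fun c hc d => by
    have hle : Submodule.span ℝ (Set.range p) ≤ W.comap (symmProd c) :=
      Submodule.span_le.2 (Set.range_subset_iff.2 hc)
    exact hle (hp ▸ Submodule.mem_top)
  refine extend a (fun i => ?_) b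
  rw [symmProd_comm]
  exact extend (p i) (h i) a

theorem IsConfiguration.isPerfect_of_symmProd_mem [FiniteDimensional ℝ E] {S : Set E}
    (hS : IsConfiguration S) {ι : Type*} {p : ι → E} (hp : Submodule.span ℝ (Set.range p) = ⊤)
    (h : ∀ i j, symmProd (p i) (p j) ∈ Submodule.span ℝ (proj '' S)) : IsPerfect S := by
  refine hS.isPerfect fun x => ?_
  have hx := symmProd_mem_of_span_eq_top hp h x x
  rw [symmProd_self] at hx
  exact (Submodule.smul_mem_iff _ two_ne_zero).1 hx

end SymmetricMaps

section ProjCone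

variable {E : Type*} [NormedAddCommGroup E] [InnerProductSpace ℝ E]

/-- The cone of non-negative combinations of the maps `P_x`, `x ∈ S`. A configuration is
semi-eutactic when `Id` lies in this cone, and eutactic when it can absorb a small positive
multiple of every `P_x`. -/
noncomputable abbrev projCone (S : Set E) : PointedCone ℝ (E →ₗ[ℝ] E) :=
  PointedCone.hull ℝ (proj '' S)

theorem proj_mem_projCone {S : Set E} {x : E} (hx : x ∈ S) : proj x ∈ projCone S :=
  Submodule.subset_span ⟨x, hx, rfl⟩

theorem IsConfiguration.exists_symmetric_coeff {S : Set E} (hS : IsConfiguration S)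
    {Q : E →ₗ[ℝ] E} (hQ : Q ∈ projCone S) : ∃ v : E → ℝ, (∀ x, v x = v (-x)) ∧ (∀ x, 0 ≤ v x) ∧
      Q = ∑ x ∈ hS.finite.toFinset, v x • proj x := by
  classical
  induction hQ using Submodule.span_induction with
  | mem x h =>
    obtain ⟨x, hx, rfl⟩ := h
    refine ⟨fun y => 1 / 2 * ((if y = x then 1 else 0) + if y = -x then 1 else 0), fun y => ?_,
      fun y => by positivity, ?_⟩
    · simp only [neg_eq_iff_eq_neg, neg_neg]; ring
    · simp only [mul_smul, add_smul, ite_smul, one_smul, zero_smul, ← Finset.smul_sum,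
        Finset.sum_add_distrib, Finset.sum_ite_eq']
      rw [if_pos (by simpa using hx), if_pos (by simpa using hS.neg_mem x hx), proj_neg]
      module
  | zero => exact ⟨0, by simp, by simp, by simp⟩
  | add x y _ _ hx hy =>
    obtain ⟨v, hv_neg, hv_nonneg, rfl⟩ := hx
    obtain ⟨w, hw_neg, hw_nonneg, rfl⟩ := hy
    exact ⟨v + w, fun x => by simp [hv_neg x, hw_neg x],
      fun x => add_nonneg (hv_nonneg x) (hw_nonneg x),
      by simp [add_smul, Finset.sum_add_distrib]⟩
  | smul a x _ hx =>
    obtain ⟨v, hv_neg, hv_nonneg, rfl⟩ := hx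
    refine ⟨fun x => a * v x, fun x => by simp [hv_neg x],
      fun x => mul_nonneg a.2 (hv_nonneg x), ?_⟩
    simp only [mul_smul, ← Finset.smul_sum]
    rfl

theorem IsConfiguration.isSemiEutactic {S : Set E} (hS : IsConfiguration S)
    (h : LinearMap.id ∈ projCone S) : IsSemiEutactic S := by
  obtain ⟨v, hsymm, hnonneg, hv⟩ := hS.exists_symmetric_coeff h
  rw [← finsum_mem_eq_finite_toFinset_sum _ hS.finite] at hv
  exact ⟨hS, v, ⟨fun x _ => hsymm x, hv⟩, fun x _ => hnonneg x⟩

theorem IsConfiguration.isEutactic {S : Set E} (hS : IsConfiguration S) {ε : ℝ} (hε : 0 < ε)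
    (h : LinearMap.id - ε • ∑ x ∈ hS.finite.toFinset, proj x ∈ projCone S) : IsEutactic S := by
  obtain ⟨v, hsymm, hnonneg, hv⟩ := hS.exists_symmetric_coeff h
  refine ⟨hS, fun x => v x + ε, ⟨fun x _ => by simp [hsymm x], ?_⟩,
    fun x _ => add_pos_of_nonneg_of_pos (hnonneg x) hε⟩
  rw [finsum_mem_eq_finite_toFinset_sum _ hS.finite]
  simp only [add_smul, Finset.sum_add_distrib, ← hv, ← Finset.smul_sum]
  abel

theorem exists_pos_id_add_smul_mem_projCone {T Y : Set E} (hYT : Y ⊆ T)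
    (hid : LinearMap.id ∈ projCone T)
    (hY : ∀ y ∈ Y, ∃ ε : ℝ, 0 < ε ∧ LinearMap.id - ε • proj y ∈ projCone T)
    {Q : E →ₗ[ℝ] E} (hQ : Q ∈ Submodule.span ℝ (proj '' Y)) :
    ∃ ε : ℝ, 0 < ε ∧ ∀ t : ℝ, |t| ≤ ε → LinearMap.id + t • Q ∈ projCone T := by
  induction hQ using Submodule.span_induction with
  | mem x h =>
    obtain ⟨y, hy, rfl⟩ := h
    obtain ⟨ε, hε, h⟩ := hY y hy
    refine ⟨ε, hε, fun t ht => ?_⟩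
    have := add_mem h ((projCone T).smul_mem (show 0 ≤ ε + t by linarith [neg_abs_le t])
      (proj_mem_projCone (hYT hy)))
    convert this using 1
    module
  | zero => exact ⟨1, one_pos, fun t _ => by simpa using hid⟩
  | add x y _ _ hx hy =>
    obtain ⟨ε, hε, h⟩ := hx
    obtain ⟨δ, hδ, h'⟩ := hy
    refine ⟨min ε δ / 2, by positivity, fun t ht => ?_⟩
    have h2 : |2 * t| ≤ min ε δ := by rw [abs_mul, abs_two]; linarith
    have := (projCone T).smul_mem (show (0 : ℝ) ≤ 1 / 2 by norm_num)
      (add_mem (h _ (h2.trans (min_le_left _ _))) (h' _ (h2.trans (min_le_right _ _))))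
    convert this using 1
    module
  | smul a x _ hx =>
    obtain ⟨ε, hε, h⟩ := hx
    refine ⟨ε / (|a| + 1), by positivity, fun t ht => ?_⟩
    rw [smul_smul]
    apply h
    rw [abs_mul]
    rw [le_div_iff₀ (by positivity)] at ht
    nlinarith [abs_nonneg t]

/-- `Id` is interior to the cone in every direction `P_y`, `y ∈ Y`, hence in all symmetric
directions; one of these is `∑ P_x`. -/
theorem IsConfiguration.isExtreme {T Y : Set E} (hT : IsConfiguration T) (hYT : Y ⊆ T)
    (hspan : ∀ Q : E →ₗ[ℝ] E, Q.IsSymmetric → Q ∈ Submodule.span ℝ (proj '' Y))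
    (hY : ∀ y ∈ Y, ∃ ε : ℝ, 0 < ε ∧ LinearMap.id - ε • proj y ∈ projCone T) : IsExtreme T := by
  have hid : LinearMap.id ∈ projCone T := by
    rcases Y.eq_empty_or_nonempty with rfl | ⟨y, hy⟩
    · have hzero : (LinearMap.id : E →ₗ[ℝ] E) = 0 := by simpa using hspan _ LinearMap.IsSymmetric.id
      exact hzero ▸ zero_mem _
    · obtain ⟨ε, hε, h⟩ := hY y hy
      simpa using add_mem h ((projCone T).smul_mem hε.le (proj_mem_projCone (hYT hy)))
  refine ⟨⟨hT, fun Q => ⟨isSymmetric_of_mem_span_proj, fun h =>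
    Submodule.span_mono (Set.image_mono hYT) (hspan Q h)⟩⟩, ?_⟩
  have hsum : (∑ x ∈ hT.finite.toFinset, proj x) ∈ Submodule.span ℝ (proj '' Y) :=
    Submodule.sum_mem _ fun x _ => hspan _ (isSymmetric_proj x)
  obtain ⟨ε, hε, h⟩ := exists_pos_id_add_smul_mem_projCone hYT hid hY hsum
  refine hT.isEutactic hε ?_
  rw [sub_eq_add_neg, ← neg_smul]
  exact h _ (by rw [abs_neg, abs_of_pos hε])

theorem sum_smul_proj_sub_mem_projCone {κ : Type*} {s : Finset κ} {c : κ → ℝ} {z : κ → E}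
    {T : Set E} (hc : ∀ k ∈ s, 0 ≤ c k) (hz : ∀ k ∈ s, z k ∈ T) {k : κ} (hk : k ∈ s) :
    ∑ l ∈ s, c l • proj (z l) - c k • proj (z k) ∈ projCone T := by
  classical
  rw [← Finset.add_sum_erase _ _ hk, add_sub_cancel_left]
  exact sum_mem fun l hl => (projCone T).smul_mem (hc l (Finset.mem_of_mem_erase hl))
    (proj_mem_projCone (hz l (Finset.mem_of_mem_erase hl)))

theorem IsExtreme.mono {S T : Set E} (hS : IsExtreme S) (hT : IsConfiguration T) (hST : S ⊆ T) :
    IsExtreme T := by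
  obtain ⟨hp, -, v, ⟨-, hv⟩, hpos⟩ := hS
  rw [finsum_mem_eq_finite_toFinset_sum _ hp.1.finite] at hv
  refine hT.isExtreme hST (fun Q hQ => (hp.2 Q).2 hQ) fun y hy => ⟨v y, hpos y hy, ?_⟩
  rw [hv]
  exact sum_smul_proj_sub_mem_projCone (fun x hx => (hpos x (by simpa using hx)).le)
    (fun x hx => hST (by simpa using hx)) (by simpa using hy)

end ProjCone

section StrongEutaxy

variable {E : Type*} [NormedAddCommGroup E] [InnerProductSpace ℝ E]

/-- A configuration all of whose eutaxy coefficients can be taken equal: `Id` is a positive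
multiple of `∑ P_x`. -/
def IsStronglyEutactic (S : Set E) : Prop :=
  IsConfiguration S ∧ ∃ c : ℝ, 0 < c ∧ (LinearMap.id : E →ₗ[ℝ] E) = c • ∑ᶠ x ∈ S, proj x

theorem IsStronglyEutactic.isEutactic {S : Set E} (hS : IsStronglyEutactic S) :
    IsEutactic S := by
  obtain ⟨hS, c, hc, hid⟩ := hS
  refine ⟨hS, fun _ => c, ⟨fun _ _ => rfl, ?_⟩, fun _ _ => hc⟩
  rw [hid, smul_finsum_mem hS.finite]

theorem proj_map (g : E ≃ₗᵢ[ℝ] E) (x y : E) : proj (g x) (g y) = g (proj x y) := by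
  rw [proj_apply, proj_apply, g.inner_map_map, map_smul]

theorem finsum_proj_map {S : Set E} (hS : S.Finite) (g : E ≃ₗᵢ[ℝ] E) (hg : Set.MapsTo g S S)
    (y : E) : (∑ᶠ x ∈ S, proj x) (g y) = g ((∑ᶠ x ∈ S, proj x) y) := by
  have happly : ∀ z, (∑ᶠ x ∈ S, proj x) z = ∑ᶠ x ∈ S, proj x z := fun z => by
    simp only [finsum_mem_eq_finite_toFinset_sum _ hS, LinearMap.sum_apply]
  have hbij : Set.BijOn g S S :=
    (hS.injOn_iff_bijOn_of_mapsTo hg).1 g.injective.injOn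
  calc (∑ᶠ x ∈ S, proj x) (g y) = ∑ᶠ x ∈ S, g (proj x y) := by
        rw [happly]
        exact (finsum_mem_eq_of_bijOn g hbij fun x _ => (proj_map g x y).symm).symm
    _ = g ((∑ᶠ x ∈ S, proj x) y) := by
        rw [happly, finsum_mem_eq_finite_toFinset_sum _ hS,
          finsum_mem_eq_finite_toFinset_sum _ hS, map_sum]

theorem reflection_eq_sub_proj {x : E} (hx : ‖x‖ = 1) (y : E) :
    (ℝ ∙ x)ᗮ.reflection y = y - (2 : ℝ) • proj x y := by
  rw [Submodule.reflection_orthogonal_apply, Submodule.reflection_singleton_apply, hx,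
    real_inner_comm, proj_apply]
  simp [two_smul]

theorem IsConfiguration.commute_finsum_proj {S : Set E} (hS : IsConfiguration S) {x : E}
    (hx : ‖x‖ = 1) (hrefl : Set.MapsTo (ℝ ∙ x)ᗮ.reflection S S) :
    Commute (∑ᶠ z ∈ S, proj z) (proj x) := by
  ext y
  have h := finsum_proj_map hS.finite _ hrefl y
  rw [reflection_eq_sub_proj hx, reflection_eq_sub_proj hx, map_sub, sub_right_inj, map_smul] at h
  exact smul_right_injective E (two_ne_zero' ℝ) h

theorem exists_eq_smul_id_of_forall_commute_proj {T : E →ₗ[ℝ] E}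
    (hT : ∀ v, Commute T (proj v)) : ∃ a : ℝ, T = a • LinearMap.id := by
  refine LinearMap.exists_eq_smul_id_of_forall_notLinearIndependent fun v hv => ?_
  have h : ⟪v, v⟫ • T v = ⟪T v, v⟫ • v := by
    simpa [proj_apply] using LinearMap.congr_fun (hT v) v
  have h' := LinearIndependent.pair_iff.1 hv (-⟪T v, v⟫) ⟪v, v⟫ (by rw [h]; module)
  have hv0 : v ≠ 0 := by simpa using hv.ne_zero 0
  exact hv0 (inner_self_eq_zero.1 h'.2)

/-- Schur's lemma in disguise: `∑ P_x` commutes with the reflections in the vectors of `S`, hence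
with every symmetric map, so it is a scalar. -/
theorem IsPerfect.isStronglyEutactic {S : Set E} (hS : IsPerfect S)
    (hrefl : ∀ x ∈ S, Set.MapsTo (ℝ ∙ x)ᗮ.reflection S S) : IsStronglyEutactic S := by
  obtain ⟨hS, hspan⟩ := hS
  refine ⟨hS, ?_⟩
  have hcomm : ∀ v, Commute (∑ᶠ z ∈ S, proj z) (proj v) := fun v => by
    have hv := (hspan _).2 (isSymmetric_proj v)
    generalize proj v = Q at hv ⊢
    induction hv using Submodule.span_induction with
    | mem P hP =>
      obtain ⟨x, hx, rfl⟩ := hP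
      exact hS.commute_finsum_proj (hS.norm_eq_one x hx) (hrefl x hx)
    | zero => exact Commute.zero_right _
    | add P Q _ _ hP hQ => exact hP.add_right hQ
    | smul a P _ hP => exact hP.smul_right a
  rcases S.eq_empty_or_nonempty with rfl | ⟨x, hx⟩
  · exact ⟨1, one_pos, by simpa using (hspan LinearMap.id).2 LinearMap.IsSymmetric.id⟩
  obtain ⟨a, ha⟩ := exists_eq_smul_id_of_forall_commute_proj hcomm
  have ha' : a = ∑ y ∈ hS.finite.toFinset, ⟪x, y⟫ ^ 2 := by
    have h := congrArg (fun T : E →ₗ[ℝ] E => ⟪T x, x⟫) ha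
    rw [finsum_mem_eq_finite_toFinset_sum _ hS.finite] at h
    simp only [LinearMap.sum_apply, sum_inner, proj_apply, real_inner_smul_left,
      LinearMap.smul_apply, LinearMap.id_apply, real_inner_self_eq_norm_sq,
      hS.norm_eq_one x hx] at h
    rw [one_pow, mul_one] at h
    exact h ▸ Finset.sum_congr rfl fun y _ => by rw [sq, real_inner_comm x y]
  have hpos : 0 < a := ha' ▸ Finset.sum_pos' (fun _ _ => sq_nonneg _) ⟨x, by simpa using hx, by
    rw [real_inner_self_eq_norm_sq, hS.norm_eq_one x hx]; norm_num⟩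
  exact ⟨a⁻¹, inv_pos.2 hpos, by rw [ha, smul_smul, inv_mul_cancel₀ hpos.ne', one_smul]⟩

end StrongEutaxy

section Frames

/-- The vectors `± f i` of a frame `f`. -/
def signedRange {ι G : Type*} [Neg G] (f : ι → G) : Set G := Set.range f ∪ Set.range (-f)

theorem signedRange_subset {ι E : Type*} [NormedAddCommGroup E] {D : Set E}
    (hD : IsConfiguration D) {f : ι → E} (hf : ∀ i, f i ∈ D) : signedRange f ⊆ D := by
  rintro _ (⟨i, rfl⟩ | ⟨i, rfl⟩)
  · exact hf i
  · exact hD.neg_mem _ (hf i)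

variable {ι κ E F : Type*} [NormedAddCommGroup E] [InnerProductSpace ℝ E]
  [NormedAddCommGroup F] [InnerProductSpace ℝ F]

theorem signedRange_comp (g : E →ₗᵢ[ℝ] F) (f : ι → E) :
    signedRange (g ∘ f) = g '' signedRange f := by
  rw [signedRange, signedRange, Set.image_union, ← Set.range_comp, ← Set.range_comp]
  congr 2
  ext i
  simp

theorem ne_and_ne_neg_of_orthonormal {f : ι → E} (hf : Orthonormal ℝ f) {i j : ι} (hij : i ≠ j) :
    f i ≠ f j ∧ f i ≠ -f j := by
  have h : ⟪f i, f j⟫ = 0 := hf.2 hij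
  constructor <;> intro heq <;> rw [heq] at h <;>
    simp [hf.1 j] at h

theorem finsum_proj_signedRange [Fintype ι] {f : ι → E} (hf : Orthonormal ℝ f) :
    ∑ᶠ x ∈ signedRange f, proj x = (2 : ℝ) • ∑ i, proj (f i) := by
  have hinj : Function.Injective f := hf.linearIndependent.injective
  have hdisj : Disjoint (Set.range f) (Set.range (-f)) := by
    rw [Set.disjoint_left]
    rintro _ ⟨i, rfl⟩ ⟨j, hj⟩
    have h : ⟪(-f) j, f i⟫ = 1 := by rw [hj, real_inner_self_eq_norm_sq, hf.1 i, one_pow]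
    rw [Pi.neg_apply, inner_neg_left] at h
    by_cases hij : j = i
    · rw [hij, real_inner_self_eq_norm_sq, hf.1 i] at h
      norm_num at h
    · rw [hf.2 hij] at h
      norm_num at h
  have hinj' : Function.Injective (-f) := neg_injective.comp hinj
  rw [signedRange, finsum_mem_union hdisj (Set.finite_range _) (Set.finite_range _),
    finsum_mem_range hinj, finsum_mem_range hinj', two_smul,
    finsum_eq_sum_of_fintype, finsum_eq_sum_of_fintype]
  simp only [Pi.neg_apply, proj_neg]

/-- Trading the vectors `± f i` of an orthonormal frame in `D` for vectors `g k` that span the same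
inertia tensor `∑ P` turns `D` into a subset of `T`. -/
structure IsExchange [Fintype ι] [Fintype κ] (D T : Set E) (f : ι → E) (g : κ → E) : Prop where
  orthonormal : Orthonormal ℝ f
  mem : ∀ i, f i ∈ D
  sum_proj : ∑ k, proj (g k) = ∑ i, proj (f i)
  mem_target : ∀ k, g k ∈ T
  diff_subset : D \ signedRange f ⊆ T

variable [Fintype ι] [Fintype κ] {D T : Set E} {f f' : ι → E} {g g' : κ → E}

theorem IsExchange.exists_id_eq (h : IsExchange D T f g) (hD : IsStronglyEutactic D) :
    ∃ c : ℝ, 0 < c ∧ (LinearMap.id : E →ₗ[ℝ] E) =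
      c • (∑ k, proj (g k) + ∑ k, proj (g k) + ∑ᶠ x ∈ D \ signedRange f, proj x) := by
  obtain ⟨hD, c, hc, hid⟩ := hD
  refine ⟨c, hc, ?_⟩
  rw [hid, ← finsum_mem_add_sdiff (signedRange_subset hD h.mem) hD.finite,
    finsum_proj_signedRange h.orthonormal, ← h.sum_proj, two_smul]

theorem IsExchange.exists_id_sub_smul_mem_projCone (h : IsExchange D T f g)
    (hD : IsStronglyEutactic D) : ∃ c : ℝ, 0 < c ∧
      ∀ y ∈ D \ signedRange f ∪ Set.range g, LinearMap.id - c • proj y ∈ projCone T := by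
  obtain ⟨c, hc, hid⟩ := h.exists_id_eq hD
  have hfin : (D \ signedRange f).Finite := hD.1.finite.sdiff
  rw [finsum_mem_eq_finite_toFinset_sum _ hfin] at hid
  have hT : ∀ x ∈ hfin.toFinset, x ∈ T := fun x hx => h.diff_subset (by simpa using hx)
  have hgsum := sum_mem fun k (_ : k ∈ Finset.univ) => proj_mem_projCone (h.mem_target k)
  have hsum := sum_mem fun x hx => proj_mem_projCone (hT x hx)
  refine ⟨c, hc, ?_⟩
  rintro y (hy | ⟨k, rfl⟩) <;> rw [hid, ← smul_sub] <;> refine (projCone _).smul_mem hc.le ?_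
  · have hrest := sum_smul_proj_sub_mem_projCone (fun _ _ => zero_le_one) hT
      (hfin.mem_toFinset.2 hy)
    simp only [one_smul] at hrest
    rw [add_sub_assoc]
    exact add_mem (add_mem hgsum hgsum) hrest
  · have hrest := sum_smul_proj_sub_mem_projCone (fun _ _ => zero_le_one)
      (fun k _ => h.mem_target k) (Finset.mem_univ k)
    simp only [one_smul] at hrest
    convert add_mem (add_mem hgsum hrest) hsum using 1
    abel

theorem IsExchange.isSemiEutactic [Nonempty κ] (h : IsExchange D T f g)
    (hD : IsStronglyEutactic D) (hT : IsConfiguration T) : IsSemiEutactic T := by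
  obtain ⟨c, hc, hid⟩ := h.exists_id_sub_smul_mem_projCone hD
  obtain ⟨k⟩ := ‹Nonempty κ›
  refine hT.isSemiEutactic ?_
  simpa using add_mem (hid (g k) (Or.inr ⟨k, rfl⟩))
    ((projCone T).smul_mem hc.le (proj_mem_projCone (h.mem_target k)))

theorem IsExchange.proj_frame_mem_span (h : IsExchange D T f g) {i₀ : ι} {Y : Set E}
    (hf : ∀ i ≠ i₀, f i ∈ Y) (hg : ∀ k, g k ∈ Y) :
    proj (f i₀) ∈ Submodule.span ℝ (proj '' Y) := by
  classical
  have hsum := h.sum_proj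
  rw [← Finset.add_sum_erase _ _ (Finset.mem_univ i₀)] at hsum
  rw [← sub_eq_of_eq_add hsum]
  exact sub_mem (sum_mem fun k _ => proj_mem_span (hg k)) (sum_mem fun i hi =>
    proj_mem_span (hf i (Finset.ne_of_mem_erase hi)))

/-- A vector of `D` other than `± f i₀` lies outside one of the two frames, and exchanging that
frame leaves room for a positive multiple of its `P`. -/
theorem IsExchange.isExtreme (h : IsExchange D T f g) (h' : IsExchange D T f' g')
    (hD : IsStronglyEutactic D) (hperf : IsPerfect D) (hT : IsConfiguration T) {i₀ : ι}
    (hDT : D \ {f i₀, -f i₀} ⊆ T) (hdisj : signedRange f ∩ signedRange f' ⊆ {f i₀, -f i₀}) :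
    IsExtreme T := by
  obtain ⟨c, hc, hid⟩ := h.exists_id_sub_smul_mem_projCone hD
  obtain ⟨c', hc', hid'⟩ := h'.exists_id_sub_smul_mem_projCone hD
  refine hT.isExtreme (Y := D \ {f i₀, -f i₀} ∪ Set.range g)
    (Set.union_subset hDT (Set.range_subset_iff.2 h.mem_target)) (fun Q hQ => ?_) ?_
  · have hle : Submodule.span ℝ (proj '' D) ≤
        Submodule.span ℝ (proj '' (D \ {f i₀, -f i₀} ∪ Set.range g)) := by
      have hf₀ := h.proj_frame_mem_span (i₀ := i₀) (Y := D \ {f i₀, -f i₀} ∪ Set.range g)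
        (fun i hi => Or.inl ⟨h.mem i, by
          simpa using ne_and_ne_neg_of_orthonormal h.orthonormal hi⟩) fun k => Or.inr ⟨k, rfl⟩
      rw [Submodule.span_le]
      rintro _ ⟨x, hx, rfl⟩
      by_cases hxf : x ∈ ({f i₀, -f i₀} : Set E)
      · rcases hxf with rfl | rfl
        · exact hf₀
        · exact (proj_neg (f i₀)).symm ▸ hf₀
      · exact proj_mem_span (Or.inl ⟨hx, hxf⟩)
    exact hle ((hperf.2 Q).2 hQ)
  · rintro y (⟨hy, hyf⟩ | hy)
    · by_cases hyf' : y ∈ signedRange f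
      · exact ⟨c', hc', hid' y (Or.inl ⟨hy, fun hy' => hyf (hdisj ⟨hyf', hy'⟩)⟩)⟩
      · exact ⟨c, hc, hid y (Or.inl ⟨hy, hyf'⟩)⟩
    · exact ⟨c, hc, hid y (Or.inr hy)⟩

end Frames

section HalfFrames

variable {E : Type*} [NormedAddCommGroup E] [InnerProductSpace ℝ E]

/-- The mirror images `f i - h` of the four frame vectors in their half-sum `h = (∑ j, f j) / 2`. -/
noncomputable def halfFrame (f : Fin 4 → E) (i : Fin 4) : E := f i - (1 / 2 : ℝ) • ∑ j, f j

theorem sum_proj_halfFrame (f : Fin 4 → E) : ∑ i, proj (halfFrame f i) = ∑ i, proj (f i) := by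
  ext y
  simp only [halfFrame, Fin.sum_univ_four, LinearMap.add_apply, proj_apply,
    real_inner_smul_right, inner_add_right, inner_sub_right]
  module

theorem inner_halfFrame {f : Fin 4 → E} (hf : Orthonormal ℝ f) (i j : Fin 4) :
    ⟪halfFrame f i, f j⟫ = if i = j then 1 / 2 else -(1 / 2) := by
  simp only [halfFrame, inner_sub_left, real_inner_smul_left, sum_inner,
    orthonormal_iff_ite.1 hf, Finset.sum_ite_eq', Finset.mem_univ, if_true]
  split_ifs <;> norm_num

theorem norm_halfFrame {f : Fin 4 → E} (hf : Orthonormal ℝ f) (i : Fin 4) :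
    ‖halfFrame f i‖ = 1 := by
  rw [← sq_eq_sq₀ (norm_nonneg _) zero_le_one, ← real_inner_self_eq_norm_sq]
  nth_rewrite 2 [halfFrame]
  simp only [inner_sub_right, real_inner_smul_right, inner_sum, inner_halfFrame hf]
  simp only [Finset.sum_ite, Finset.sum_const, Finset.filter_eq, Finset.filter_ne]
  norm_num [Finset.filter_ne]

theorem halfFrame_notMem_pair {f : Fin 4 → E} (hf : Orthonormal ℝ f) (i j : Fin 4) :
    halfFrame f i ∉ ({f j, -f j} : Set E) := by
  have h := inner_halfFrame hf i j
  rintro (hx | hx) <;> rw [hx] at h <;> split_ifs at h <;> norm_num [hf.1 j] at h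

end HalfFrames

section Lattices

/-- The vectors of norm one in a lattice. -/
def unitVectors {E : Type*} [NormedAddCommGroup E] (Λ : Submodule ℤ E) : Set E :=
  {x | x ∈ Λ ∧ ‖x‖ = 1}

theorem neg_mem_unitVectors {E : Type*} [NormedAddCommGroup E] {Λ : Submodule ℤ E} {x : E}
    (hx : x ∈ unitVectors Λ) : -x ∈ unitVectors Λ :=
  ⟨neg_mem hx.1, by rw [norm_neg, hx.2]⟩

theorem isConfiguration_unitVectors {E : Type*} [NormedAddCommGroup E] {Λ : Submodule ℤ E}
    (h : (unitVectors Λ).Finite) : IsConfiguration (unitVectors Λ) :=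
  ⟨h, fun _ hx => hx.2, fun _ => neg_mem_unitVectors⟩

theorem IsConfiguration.diff_pair {E : Type*} [NormedAddCommGroup E] {S : Set E}
    (hS : IsConfiguration S) (x : E) : IsConfiguration (S \ {x, -x}) where
  finite := hS.finite.subset Set.sdiff_subset
  norm_eq_one y hy := hS.norm_eq_one y hy.1
  neg_mem y hy := ⟨hS.neg_mem y hy.1, fun h => hy.2 (by
    rcases h with h | h
    · exact Or.inr (by rw [Set.mem_singleton_iff, ← h, neg_neg])
    · exact Or.inl (neg_injective h))⟩

variable {E : Type*} [NormedAddCommGroup E] [InnerProductSpace ℝ E] {Λ : Submodule ℤ E} {x y : E}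

theorem mem_unitVectors_iff : x ∈ unitVectors Λ ↔ x ∈ Λ ∧ ⟪x, x⟫ = 1 := by
  rw [real_inner_self_eq_norm_sq, pow_eq_one_iff_of_nonneg (norm_nonneg x) two_ne_zero]
  rfl

theorem minimalConfiguration_eq_unitVectors (hne : (unitVectors Λ).Nonempty)
    (hmin : ∀ x ∈ Λ, x ≠ 0 → 1 ≤ ⟪x, x⟫) : minimalConfiguration Λ = unitVectors Λ := by
  obtain ⟨u, hu⟩ := hne
  have huu := (mem_unitVectors_iff.1 hu).2
  have hminVec : minimalVectors Λ = unitVectors Λ := by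
    ext x
    rw [mem_unitVectors_iff]
    constructor
    · rintro ⟨hx, hx0, hle⟩
      exact ⟨hx, (huu ▸ hle u hu.1 (by rintro rfl; simp at huu)).antisymm (hmin x hx hx0)⟩
    · rintro ⟨hx, hx1⟩
      exact ⟨hx, by rintro rfl; simp at hx1, fun y hy hy0 => hx1 ▸ hmin y hy hy0⟩
  rw [minimalConfiguration, hminVec]
  refine (Set.image_congr fun x hx => ?_).trans (Set.image_id _)
  simp [hx.2]

/-- All inner products between vectors of `Λ` lie in `½ℤ`; in such a lattice a unit vector acts as
a root, with integral Cartan numbers `2 ⟨x, y⟩`. -/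
def IsHalfIntegral (Λ : Submodule ℤ E) : Prop :=
  ∀ x ∈ Λ, ∀ y ∈ Λ, ∃ k : ℤ, 2 * ⟪x, y⟫ = k

theorem IsHalfIntegral.reflection_mem (hΛ : IsHalfIntegral Λ) (hx : x ∈ unitVectors Λ)
    (hy : y ∈ Λ) : (ℝ ∙ x)ᗮ.reflection y ∈ Λ := by
  obtain ⟨k, hk⟩ := hΛ y hy x hx.1
  rw [reflection_eq_sub_proj hx.2, proj_apply, smul_smul, hk, Int.cast_smul_eq_zsmul]
  exact sub_mem hy (Λ.smul_mem k hx.1)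

theorem IsHalfIntegral.mapsTo_reflection (hΛ : IsHalfIntegral Λ) (hx : x ∈ unitVectors Λ) :
    Set.MapsTo (ℝ ∙ x)ᗮ.reflection (unitVectors Λ) (unitVectors Λ) := fun y hy =>
  ⟨hΛ.reflection_mem hx hy.1, by rw [LinearIsometryEquiv.norm_map, hy.2]⟩

theorem IsHalfIntegral.isStronglyEutactic (hΛ : IsHalfIntegral Λ)
    (hperf : IsPerfect (unitVectors Λ)) : IsStronglyEutactic (unitVectors Λ) :=
  hperf.isStronglyEutactic fun _ hx => hΛ.mapsTo_reflection hx

theorem IsHalfIntegral.sub_mem_unitVectors_or_eq (hΛ : IsHalfIntegral Λ)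
    (hx : x ∈ unitVectors Λ) (hy : y ∈ unitVectors Λ) (hpos : 0 < ⟪x, y⟫) :
    x - y ∈ unitVectors Λ ∨ y = x := by
  obtain ⟨k, hk⟩ := hΛ x hx.1 y hy.1
  have hle : ⟪x, y⟫ ≤ 1 := by simpa [hx.2, hy.2] using real_inner_le_norm x y
  have hk₀ : 0 < k := by rify; linarith
  have hk₂ : k ≤ 2 := by rify; linarith
  interval_cases k
  · refine Or.inl (mem_unitVectors_iff.2 ⟨sub_mem hx.1 hy.1, ?_⟩)
    rw [real_inner_sub_sub_self, (mem_unitVectors_iff.1 hx).2, (mem_unitVectors_iff.1 hy).2]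
    push_cast at hk
    linarith
  · refine Or.inr ((inner_eq_one_iff_of_norm_eq_one (𝕜 := ℝ) hx.2 hy.2).1 ?_).symm
    push_cast at hk
    linarith

theorem IsHalfIntegral.exists_sign_sub_mem_unitVectors_or_eq (hΛ : IsHalfIntegral Λ)
    (hx : x ∈ unitVectors Λ) (hy : y ∈ unitVectors Λ) (hxy : ⟪x, y⟫ ≠ 0) :
    ∃ s : ℝ, (s = 1 ∨ s = -1) ∧ (x - s • y ∈ unitVectors Λ ∨ y = s • x) := by
  rcases hxy.lt_or_gt with h | h
  · refine ⟨-1, Or.inr rfl, ?_⟩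
    have := hΛ.sub_mem_unitVectors_or_eq hx (neg_mem_unitVectors hy)
      (by rw [inner_neg_right]; linarith)
    rwa [neg_one_smul, neg_one_smul, ← neg_eq_iff_eq_neg]
  · refine ⟨1, Or.inl rfl, ?_⟩
    simpa only [one_smul] using hΛ.sub_mem_unitVectors_or_eq hx hy h

/-- An orthonormal quadruple of vectors of `Λ₀` whose half-sum lies in `Λ`. -/
structure IsHalvedFrame (Λ₀ Λ : Submodule ℤ E) (f : Fin 4 → E) : Prop where
  orthonormal : Orthonormal ℝ f
  mem : ∀ i, f i ∈ Λ₀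
  half_sum_mem : (1 / 2 : ℝ) • ∑ i, f i ∈ Λ

theorem IsHalvedFrame.map {Λ₀ : Submodule ℤ E} {f : Fin 4 → E} (h : IsHalvedFrame Λ₀ Λ f)
    (g : E →ₗᵢ[ℝ] E) (hg₀ : ∀ y ∈ Λ₀, g y ∈ Λ₀) (hg : ∀ y ∈ Λ, g y ∈ Λ) :
    IsHalvedFrame Λ₀ Λ (g ∘ f) where
  orthonormal := h.orthonormal.comp_linearIsometry g
  mem i := hg₀ _ (h.mem i)
  half_sum_mem := by simpa using hg _ h.half_sum_mem

theorem IsHalvedFrame.isExchange {Λ₀ : Submodule ℤ E} {f : Fin 4 → E}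
    (h : IsHalvedFrame Λ₀ Λ f) (hle : Λ₀ ≤ Λ) :
    IsExchange (unitVectors Λ₀) (unitVectors Λ \ {f 0, -f 0}) f (halfFrame f) where
  orthonormal := h.orthonormal
  mem i := ⟨h.mem i, h.orthonormal.1 i⟩
  sum_proj := sum_proj_halfFrame f
  mem_target i := ⟨⟨sub_mem (hle (h.mem i)) h.half_sum_mem, norm_halfFrame h.orthonormal i⟩,
    halfFrame_notMem_pair h.orthonormal i 0⟩
  diff_subset y hy := by
    refine ⟨⟨hle hy.1.1, hy.1.2⟩, ?_⟩
    rintro (rfl | rfl)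
    exacts [hy.2 (Or.inl ⟨0, rfl⟩), hy.2 (Or.inr ⟨0, rfl⟩)]

/-- Two halved frames starting with `x` that share no other vectors, up to sign: enough to exchange
`± x` away while keeping a positive multiple of every other `P_y`. -/
def HasFramePair (Λ₀ Λ : Submodule ℤ E) (x : E) : Prop :=
  ∃ f f' : Fin 4 → E, IsHalvedFrame Λ₀ Λ f ∧ IsHalvedFrame Λ₀ Λ f' ∧ f 0 = x ∧ f' 0 = x ∧
    signedRange f ∩ signedRange f' ⊆ {x, -x}

theorem HasFramePair.isExtreme_diff {Λ₀ : Submodule ℤ E} (h : HasFramePair Λ₀ Λ x)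
    (hle : Λ₀ ≤ Λ) (hΛ₀ : IsHalfIntegral Λ₀) (hperf : IsPerfect (unitVectors Λ₀))
    (hfin : (unitVectors Λ).Finite) : IsExtreme (unitVectors Λ \ {x, -x}) := by
  obtain ⟨f, f', hf, hf', rfl, h₀, hdisj⟩ := h
  refine (hf.isExchange hle).isExtreme (h₀ ▸ hf'.isExchange hle) (hΛ₀.isStronglyEutactic hperf)
    hperf ((isConfiguration_unitVectors hfin).diff_pair _) ?_ hdisj
  exact Set.sdiff_subset_sdiff_left fun y hy => ⟨hle hy.1, hy.2⟩

theorem HasFramePair.map {Λ₀ : Submodule ℤ E} (h : HasFramePair Λ₀ Λ x)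
    (g : E →ₗᵢ[ℝ] E) (hg₀ : ∀ y ∈ Λ₀, g y ∈ Λ₀) (hg : ∀ y ∈ Λ, g y ∈ Λ) :
    HasFramePair Λ₀ Λ (g x) := by
  obtain ⟨f, f', hf, hf', rfl, h₀, hdisj⟩ := h
  refine ⟨g ∘ f, g ∘ f', hf.map g hg₀ hg, hf'.map g hg₀ hg, rfl, congrArg g h₀, ?_⟩
  rw [signedRange_comp, signedRange_comp, ← Set.image_inter g.injective, ← map_neg,
    ← Set.image_pair]
  exact Set.image_mono hdisj

theorem HasFramePair.neg {Λ₀ : Submodule ℤ E} (h : HasFramePair Λ₀ Λ x) :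
    HasFramePair Λ₀ Λ (-x) := by
  simpa using h.map (LinearIsometryEquiv.neg ℝ).toLinearIsometry
    (fun y hy => by simpa using hy) (fun y hy => by simpa using hy)

/-- If `x - y` is a root, the reflection in it takes `x` to `y`. -/
theorem HasFramePair.of_inner_ne_zero (hΛ : IsHalfIntegral Λ)
    (hx : x ∈ unitVectors Λ) (hy : y ∈ unitVectors Λ) (hxy : ⟪x, y⟫ ≠ 0)
    (h : HasFramePair Λ Λ x) : HasFramePair Λ Λ y := by
  have of_sub_mem : ∀ z, ‖z‖ = 1 → x - z ∈ unitVectors Λ → HasFramePair Λ Λ z := fun z hz hxz => by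
    have hmap := h.map (ℝ ∙ (x - z))ᗮ.reflection.toLinearIsometry
      (fun w hw => hΛ.reflection_mem hxz hw) (fun w hw => hΛ.reflection_mem hxz hw)
    rwa [LinearIsometryEquiv.coe_toLinearIsometry,
      Submodule.reflection_sub (hx.2.trans hz.symm)] at hmap
  obtain ⟨s, rfl | rfl, hs | hs⟩ := hΛ.exists_sign_sub_mem_unitVectors_or_eq hx hy hxy
  · exact of_sub_mem y hy.2 (by rwa [one_smul] at hs)
  · rwa [hs, one_smul]
  · rw [neg_one_smul] at hs
    simpa using (of_sub_mem (-y) (by rw [norm_neg, hy.2]) hs).neg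
  · rw [hs, neg_one_smul]
    exact h.neg

theorem IsHalfIntegral.symmProd_mem_of_inner_ne_zero (hΛ : IsHalfIntegral Λ)
    (hx : x ∈ unitVectors Λ) (hy : y ∈ unitVectors Λ) (hxy : ⟪x, y⟫ ≠ 0) :
    symmProd x y ∈ Submodule.span ℝ (proj '' unitVectors Λ) := by
  obtain ⟨s, hsign, hs | rfl⟩ := hΛ.exists_sign_sub_mem_unitVectors_or_eq hx hy hxy
  · have h := sub_mem (add_mem (proj_mem_span hx)
      (Submodule.smul_mem _ (s ^ 2) (proj_mem_span hy))) (proj_mem_span hs)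
    rw [proj_sub, proj_smul, sub_sub_cancel, map_smul] at h
    rcases hsign with rfl | rfl <;> simpa using h
  · rw [map_smul, symmProd_self]
    exact Submodule.smul_mem _ _ (Submodule.smul_mem _ _ (proj_mem_span hx))

/-- Here `y` may be orthogonal to `x`; the identity
`symmProd x y = symmProd (x - s • t) y + s • symmProd t y` reduces this case to non-orthogonal
pairs. -/
theorem IsHalfIntegral.symmProd_mem_of_linked (hΛ : IsHalfIntegral Λ) (hx : x ∈ unitVectors Λ)
    (hy : y ∈ unitVectors Λ) {t : E} (ht : t ∈ unitVectors Λ) (htx : ⟪x, t⟫ ≠ 0)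
    (hty : ⟪t, y⟫ ≠ 0) : symmProd x y ∈ Submodule.span ℝ (proj '' unitVectors Λ) := by
  by_cases hxy : ⟪x, y⟫ = 0
  swap
  · exact hΛ.symmProd_mem_of_inner_ne_zero hx hy hxy
  have hty' := hΛ.symmProd_mem_of_inner_ne_zero ht hy hty
  obtain ⟨s, hs, hst | rfl⟩ := hΛ.exists_sign_sub_mem_unitVectors_or_eq hx ht htx
  · have hinner : ⟪x - s • t, y⟫ ≠ 0 := by
      rw [inner_sub_left, hxy, real_inner_smul_left]
      rcases hs with rfl | rfl <;> simpa using hty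
    have h := add_mem (hΛ.symmProd_mem_of_inner_ne_zero hst hy hinner)
      (Submodule.smul_mem _ s hty')
    simpa using h
  · rw [real_inner_smul_left, hxy, mul_zero] at hty
    exact absurd rfl hty

theorem IsHalfIntegral.exists_linked_of_reflTransGen (hΛ : IsHalfIntegral Λ) {ι : Type*}
    {p : ι → E} (hp : ∀ i, p i ∈ unitVectors Λ) {i j : ι}
    (hij : Relation.ReflTransGen (fun i j => ⟪p i, p j⟫ ≠ 0) i j) :
    ∃ t ∈ unitVectors Λ, ⟪p i, t⟫ ≠ 0 ∧ ⟪t, p j⟫ ≠ 0 := by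
  induction hij with
  | refl =>
    have h := (mem_unitVectors_iff.1 (hp i)).2
    exact ⟨p i, hp i, by rw [h]; exact one_ne_zero, by rw [h]; exact one_ne_zero⟩
  | @tail j k _ hjk ih =>
    obtain ⟨t, ht, hit, htj⟩ := ih
    by_cases hij : ⟪p i, p j⟫ = 0
    swap
    · exact ⟨p j, hp j, hij, hjk⟩
    by_cases htk : ⟪t, p k⟫ = 0
    swap
    · exact ⟨t, ht, hit, htk⟩
    obtain ⟨s, hs, hst | hst⟩ := hΛ.exists_sign_sub_mem_unitVectors_or_eq ht (hp j) htj
    · refine ⟨t - s • p j, hst, ?_, ?_⟩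
      · rwa [inner_sub_right, real_inner_smul_right, hij, mul_zero, sub_zero]
      · rw [inner_sub_left, real_inner_smul_left, htk]
        rcases hs with rfl | rfl <;> simpa using hjk
    · rw [hst, real_inner_smul_left, htk, mul_zero] at hjk
      exact absurd rfl hjk

theorem IsHalfIntegral.isPerfect_unitVectors [FiniteDimensional ℝ E] (hΛ : IsHalfIntegral Λ)
    (hfin : (unitVectors Λ).Finite) {ι : Type*} {p : ι → E} (hp : ∀ i, p i ∈ unitVectors Λ)
    (hspan : Submodule.span ℝ (Set.range p) = ⊤)
    (hconn : ∀ i j, Relation.ReflTransGen (fun i j => ⟪p i, p j⟫ ≠ 0) i j) :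
    IsPerfect (unitVectors Λ) := by
  refine (isConfiguration_unitVectors hfin).isPerfect_of_symmProd_mem hspan fun i j => ?_
  obtain ⟨t, ht, hit, htj⟩ := hΛ.exists_linked_of_reflTransGen hp (hconn i j)
  exact hΛ.symmProd_mem_of_linked (hp i) (hp j) ht hit htj

end Lattices

section SimpleSystems

variable {ι E F : Type*} [NormedAddCommGroup E] [InnerProductSpace ℝ E]
  [NormedAddCommGroup F] [InnerProductSpace ℝ F]

/-- A system of simple roots for the simply laced Cartan matrix `C`, normalised to unit length:
linearly independent vectors with Gram matrix `C / 2`. -/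
structure IsSimpleSystem (C : Matrix ι ι ℤ) (a : ι → E) : Prop where
  linearIndependent : LinearIndependent ℝ a
  inner_eq : ∀ i j, ⟪a i, a j⟫ = (C i j : ℝ) / 2

/-- `C` has diagonal entries `2` and a connected Dynkin diagram, as a Cartan matrix of an
irreducible simply laced root system does. -/
structure IsConnectedCartan (C : Matrix ι ι ℤ) : Prop where
  diag : ∀ i, C i i = 2
  connected : ∀ i j, Relation.ReflTransGen (fun i j => C i j ≠ 0) i j

/-- The lattice generated by `a`. -/
abbrev rootLattice {G : Type*} [AddCommGroup G] (a : ι → G) : Submodule ℤ G :=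
  Submodule.span ℤ (Set.range a)

theorem rootLattice_comp (g : E →ₗᵢ[ℝ] F) (a : ι → E) :
    (rootLattice (g ∘ a) : Set F) = g '' rootLattice a := by
  have h := Submodule.map_span (g.toLinearMap.restrictScalars ℤ) (Set.range a)
  rw [← Set.range_comp] at h
  exact (congrArg SetLike.coe h).symm

theorem unitVectors_rootLattice_comp (g : E →ₗᵢ[ℝ] F) (a : ι → E) :
    unitVectors (rootLattice (g ∘ a)) = g '' unitVectors (rootLattice a) := by
  ext y
  rw [unitVectors, Set.mem_ofPred_eq, ← SetLike.mem_coe, rootLattice_comp]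
  constructor
  · rintro ⟨⟨x, hx, rfl⟩, hnorm⟩
    exact ⟨x, ⟨hx, by rwa [g.norm_map] at hnorm⟩, rfl⟩
  · rintro ⟨x, ⟨hx, hnorm⟩, rfl⟩
    exact ⟨⟨x, hx, rfl⟩, by rwa [g.norm_map]⟩

theorem reflTransGen_of_forall_exists_lt {r : ι → ι → Prop} [Std.Symm r]
    (f : ι → ℕ) (o : ι) (h : ∀ i, i ≠ o → ∃ j, r i j ∧ f j < f i) (i j : ι) :
    Relation.ReflTransGen r i j := by
  have to_root : ∀ i, Relation.ReflTransGen r i o := fun i => by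
    induction hi : f i using Nat.strong_induction_on generalizing i with
    | _ m ih =>
      by_cases hio : i = o
      · rw [hio]
      · obtain ⟨j, hij, hlt⟩ := h i hio
        exact .head hij (ih (f j) (hi ▸ hlt) j rfl)
  exact (to_root i).trans (symm (to_root j))

theorem IsConnectedCartan.of_forall_exists_lt {C : Matrix ι ι ℤ} (hdiag : ∀ i, C i i = 2)
    (hsymm : C.IsSymm) (f : ι → ℕ) (o : ι) (h : ∀ i, i ≠ o → ∃ j, C i j ≠ 0 ∧ f j < f i) :
    IsConnectedCartan C :=
  have : Std.Symm fun i j => C i j ≠ 0 := ⟨fun i j hij => by rwa [hsymm.apply]⟩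
  ⟨hdiag, reflTransGen_of_forall_exists_lt f o h⟩

variable {C : Matrix ι ι ℤ} {a : ι → E}

theorem IsSimpleSystem.exists_linearIsometry (ha : IsSimpleSystem C a)
    (hspan : Submodule.span ℝ (Set.range a) = ⊤) {b : ι → F} (hb : IsSimpleSystem C b) :
    ∃ g : E →ₗᵢ[ℝ] F, g ∘ a = b := by
  let B := Module.Basis.mk ha.linearIndependent hspan.ge
  have hB : ⇑B = a := Module.Basis.coe_mk _ _
  have hconstr : ∀ i, B.constr ℝ b (a i) = b i := fun i => by
    rw [← congrFun hB i, B.constr_basis]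
  refine ⟨(B.constr ℝ b).isometryOfInner fun x y => ?_, funext hconstr⟩
  have hx : x ∈ Submodule.span ℝ (Set.range a) := hspan ▸ Submodule.mem_top
  have hy : y ∈ Submodule.span ℝ (Set.range a) := hspan ▸ Submodule.mem_top
  induction hx, hy using Submodule.span_induction₂ with
  | mem_mem x y hx hy =>
    obtain ⟨i, rfl⟩ := hx
    obtain ⟨j, rfl⟩ := hy
    rw [hconstr, hconstr, ha.inner_eq, hb.inner_eq]
  | zero_left => simp
  | zero_right => simp
  | add_left x y z _ _ _ hx hy => rw [map_add, inner_add_left, inner_add_left, hx, hy]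
  | add_right x y z _ _ _ hx hy => rw [map_add, inner_add_right, inner_add_right, hx, hy]
  | smul_left r x y _ _ h => rw [map_smul, real_inner_smul_left, real_inner_smul_left, h]
  | smul_right r x y _ _ h => rw [map_smul, real_inner_smul_right, real_inner_smul_right, h]

theorem IsSimpleSystem.mem_unitVectors (ha : IsSimpleSystem C a) (hC : ∀ i, C i i = 2) (i : ι) :
    a i ∈ unitVectors (rootLattice a) :=
  mem_unitVectors_iff.2 ⟨Submodule.subset_span ⟨i, rfl⟩, by rw [ha.inner_eq, hC]; norm_num⟩

theorem IsSimpleSystem.of_inner_eq [Finite ι] (ha : IsSimpleSystem C a) {b : ι → F}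
    (hb : ∀ i j, ⟪b i, b j⟫ = (C i j : ℝ) / 2) : IsSimpleSystem C b := by
  classical
  have := Fintype.ofFinite ι
  refine ⟨Matrix.linearIndependent_of_det_gram_ne_zero ?_, hb⟩
  have hgram : Matrix.gram ℝ b = Matrix.gram ℝ a := by
    ext i j; rw [Matrix.gram_apply, Matrix.gram_apply, hb, ha.inner_eq]
  rw [hgram]
  exact Matrix.det_gram_ne_zero_iff_linearIndependent.2 ha.linearIndependent

theorem IsSimpleSystem.inner_linearCombination [Fintype ι] (ha : IsSimpleSystem C a)
    (z z' : ι → ℤ) :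
    ⟪Fintype.linearCombination ℤ a z, Fintype.linearCombination ℤ a z'⟫ =
      ((z ⬝ᵥ C.mulVec z' : ℤ) : ℝ) / 2 := by
  simp only [Fintype.linearCombination_apply, sum_inner, inner_sum, ← Int.cast_smul_eq_zsmul ℝ,
    real_inner_smul_left, real_inner_smul_right, ha.inner_eq, dotProduct, Matrix.mulVec,
    Finset.mul_sum, Int.cast_sum, Finset.sum_div]
  rw [Finset.sum_comm]
  refine Finset.sum_congr rfl fun i _ => Finset.sum_congr rfl fun j _ => ?_
  push_cast
  ring

theorem IsSimpleSystem.isHalfIntegral (ha : IsSimpleSystem C a) :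
    IsHalfIntegral (rootLattice a) := by
  intro x hx y hy
  induction hx, hy using Submodule.span_induction₂ with
  | mem_mem x y hx hy =>
    obtain ⟨i, rfl⟩ := hx
    obtain ⟨j, rfl⟩ := hy
    exact ⟨C i j, by rw [ha.inner_eq]; ring⟩
  | zero_left => exact ⟨0, by simp⟩
  | zero_right => exact ⟨0, by simp⟩
  | add_left x y z _ _ _ hx hy =>
    obtain ⟨k, hk⟩ := hx
    obtain ⟨l, hl⟩ := hy
    exact ⟨k + l, by rw [inner_add_left, mul_add, hk, hl, Int.cast_add]⟩
  | add_right x y z _ _ _ hx hy =>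
    obtain ⟨k, hk⟩ := hx
    obtain ⟨l, hl⟩ := hy
    exact ⟨k + l, by rw [inner_add_right, mul_add, hk, hl, Int.cast_add]⟩
  | smul_left r x y _ _ h =>
    obtain ⟨k, hk⟩ := h
    refine ⟨r * k, ?_⟩
    rw [← Int.cast_smul_eq_zsmul ℝ, real_inner_smul_left, mul_left_comm, hk, Int.cast_mul]
  | smul_right r x y _ _ h =>
    obtain ⟨k, hk⟩ := h
    refine ⟨r * k, ?_⟩
    rw [← Int.cast_smul_eq_zsmul ℝ, real_inner_smul_right, mul_left_comm, hk, Int.cast_mul]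

theorem IsSimpleSystem.exists_inner_self_eq (ha : IsSimpleSystem C a) (hC : ∀ i, C i i = 2)
    {x : E} (hx : x ∈ rootLattice a) : ∃ k : ℤ, ⟪x, x⟫ = k := by
  induction hx using Submodule.span_induction with
  | mem x hx => obtain ⟨i, rfl⟩ := hx; exact ⟨1, by rw [ha.inner_eq, hC]; norm_num⟩
  | zero => exact ⟨0, by simp⟩
  | add x y hx hy hkx hky =>
    obtain ⟨k, hk⟩ := hkx
    obtain ⟨l, hl⟩ := hky
    obtain ⟨m, hm⟩ := ha.isHalfIntegral x hx y hy
    exact ⟨k + m + l, by rw [real_inner_add_add_self]; push_cast; linarith⟩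
  | smul r x _ hkx =>
    obtain ⟨k, hk⟩ := hkx
    refine ⟨r ^ 2 * k, ?_⟩
    rw [← Int.cast_smul_eq_zsmul ℝ, real_inner_smul_right, real_inner_smul_left, hk]
    push_cast; ring

theorem IsSimpleSystem.minimalConfiguration_eq [Nonempty ι] (ha : IsSimpleSystem C a)
    (hC : ∀ i, C i i = 2) :
    minimalConfiguration (rootLattice a) = unitVectors (rootLattice a) := by
  obtain ⟨i⟩ := ‹Nonempty ι›
  refine minimalConfiguration_eq_unitVectors ⟨a i, ha.mem_unitVectors hC i⟩ fun x hx hx₀ => ?_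
  obtain ⟨k, hk⟩ := ha.exists_inner_self_eq hC hx
  have hpos : 0 < ⟪x, x⟫ := real_inner_self_pos.2 hx₀
  rw [hk] at hpos ⊢
  exact_mod_cast hpos

section Spanning

variable [Finite ι] (ha : IsSimpleSystem C a) (hspan : Submodule.span ℝ (Set.range a) = ⊤)
include ha hspan

theorem IsSimpleSystem.finite_unitVectors : (unitVectors (rootLattice a)).Finite := by
  let B := Module.Basis.mk ha.linearIndependent hspan.ge
  have hB : ⇑B = a := Module.Basis.coe_mk _ _
  have : FiniteDimensional ℝ E := B.finiteDimensional_of_finite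
  refine (ZSpan.setFinite_inter B (Metric.isBounded_closedBall (x := (0 : E)) (r := 1))).subset ?_
  rintro x ⟨hx, hnorm⟩
  exact ⟨by simp [hnorm], by rwa [hB]⟩

variable (hC : IsConnectedCartan C)
include hC

theorem IsSimpleSystem.isPerfect : IsPerfect (unitVectors (rootLattice a)) := by
  have : FiniteDimensional ℝ E :=
    (Module.Basis.mk ha.linearIndependent hspan.ge).finiteDimensional_of_finite
  refine ha.isHalfIntegral.isPerfect_unitVectors (ha.finite_unitVectors hspan)
    (ha.mem_unitVectors hC.diag) hspan fun i j =>
      Relation.ReflTransGen.mono (fun i j hij => ?_) _ _ (hC.connected i j)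
  rw [ha.inner_eq]
  exact div_ne_zero (Int.cast_ne_zero.2 hij) two_ne_zero

theorem IsSimpleSystem.isStronglyEutactic : IsStronglyEutactic (unitVectors (rootLattice a)) :=
  ha.isHalfIntegral.isStronglyEutactic (ha.isPerfect hspan hC)

theorem IsSimpleSystem.isExtreme : IsExtreme (unitVectors (rootLattice a)) :=
  ⟨ha.isPerfect hspan hC, (ha.isStronglyEutactic hspan hC).isEutactic⟩

/-- The Weyl group moves the given frame pair along the Dynkin diagram to every simple root, and
from a simple root that is not orthogonal to `y` to `y`. -/
theorem IsSimpleSystem.isRedundantlyExtreme {i : ι}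
    (h : HasFramePair (rootLattice a) (rootLattice a) (a i)) :
    IsRedundantlyExtreme (unitVectors (rootLattice a)) := by
  have hmem := ha.mem_unitVectors hC.diag
  have simple_roots : ∀ j, HasFramePair (rootLattice a) (rootLattice a) (a j) := fun j => by
    induction hC.connected i j with
    | refl => exact h
    | tail _ hjk ih =>
      refine ih.of_inner_ne_zero ha.isHalfIntegral (hmem _) (hmem _) ?_
      rw [ha.inner_eq]
      exact div_ne_zero (Int.cast_ne_zero.2 hjk) two_ne_zero
  refine ⟨ha.isExtreme hspan hC, fun y hy => ?_⟩
  obtain ⟨j, hj⟩ : ∃ j, ⟪a j, y⟫ ≠ 0 := by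
    by_contra! horth
    have hy₀ : y = 0 := InnerProductSpace.ext_inner_left_basis (𝕜 := ℝ)
      (Module.Basis.mk ha.linearIndependent hspan.ge) fun j => by simp [horth]
    simpa [hy₀] using hy.2
  exact ((simple_roots j).of_inner_ne_zero ha.isHalfIntegral (hmem j) hy hj).isExtreme_diff le_rfl
    ha.isHalfIntegral (ha.isPerfect hspan hC) (ha.finite_unitVectors hspan)

end Spanning

section IsRootLattice

variable {n : ℕ} {C : Matrix (Fin n) (Fin n) ℤ} {v : Fin n → F}

theorem IsSimpleSystem.exists_of_isRootLattice (hv : IsSimpleSystem C v)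
    {Λ : Submodule ℤ (EuclideanSpace ℝ (Fin n))} (hΛ : IsRootLattice C Λ) :
    ∃ a : Fin n → EuclideanSpace ℝ (Fin n), IsSimpleSystem C a ∧
      Submodule.span ℝ (Set.range a) = ⊤ ∧ Λ = rootLattice a := by
  obtain ⟨a, ha, rfl⟩ := hΛ
  have hsimple := hv.of_inner_eq ha
  exact ⟨a, hsimple, hsimple.linearIndependent.span_eq_top_of_card_eq_finrank' (by simp), rfl⟩

theorem IsSimpleSystem.exists_isRootLattice (hv : IsSimpleSystem C v) :
    ∃ Λ, IsRootLattice C Λ := by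
  have hrank : Module.finrank ℝ (Submodule.span ℝ (Set.range v)) = n := by
    simpa using finrank_span_eq_card hv.linearIndependent
  have : FiniteDimensional ℝ (Submodule.span ℝ (Set.range v)) :=
    .span_of_finite ℝ (Set.finite_range v)
  let u : Fin n → Submodule.span ℝ (Set.range v) := fun i => ⟨v i, Submodule.subset_span ⟨i, rfl⟩⟩
  let e := (stdOrthonormalBasis ℝ (Submodule.span ℝ (Set.range v))).reindex (finCongr hrank)
  refine ⟨_, fun i => e.repr (u i), fun i j => ?_, rfl⟩
  rw [LinearIsometryEquiv.inner_map_map]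
  exact hv.inner_eq i j

end IsRootLattice

end SimpleSystems

section ScaledFrames

theorem exists_of_sum_sq_eq_two {ι : Type*} [Fintype ι] {z : ι → ℤ} (h : ∑ i, z i ^ 2 = 2) :
    ∃ i j, i ≠ j ∧ z i ^ 2 = 1 ∧ z j ^ 2 = 1 ∧ ∀ k, k ≠ i ∧ k ≠ j → z k = 0 := by
  have sq_eq_one : ∀ i, z i ≠ 0 → z i ^ 2 = 1 := fun i hi => by
    have hle : z i ^ 2 ≤ 2 := h ▸ Finset.single_le_sum (f := fun i => z i ^ 2)
      (fun _ _ => sq_nonneg _) (Finset.mem_univ i)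
    have habs : |z i| ≤ 1 := by
      by_contra! hlt
      nlinarith [sq_abs (z i)]
    rw [← sq_abs, (Int.one_le_abs hi).antisymm' habs, one_pow]
  classical
  have hcard : (Finset.univ.filter fun i => z i ≠ 0).card = 2 := by
    zify
    rw [← h, ← Finset.sum_boole]
    refine Finset.sum_congr rfl fun i _ => ?_
    split_ifs with hi
    · exact (sq_eq_one i hi).symm
    · rw [not_not.1 hi, zero_pow two_ne_zero]
  obtain ⟨i, j, hij, hsupp⟩ := Finset.card_eq_two.1 hcard
  have mem_supp : ∀ k, z k ≠ 0 ↔ k = i ∨ k = j := fun k => by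
    simpa using Finset.ext_iff.1 hsupp k
  exact ⟨i, j, hij, sq_eq_one i ((mem_supp i).2 (Or.inl rfl)),
    sq_eq_one j ((mem_supp j).2 (Or.inr rfl)), fun k hk => by
      by_contra hk₀
      exact ((mem_supp k).1 hk₀).elim hk.1 hk.2⟩

variable {ι : Type*} [DecidableEq ι] {E F : Type*} [NormedAddCommGroup E] [InnerProductSpace ℝ E]
  [NormedAddCommGroup F] [InnerProductSpace ℝ F]

/-- Pairwise orthogonal vectors of squared norm `1/2`. In this scale the root systems of types `A`
and `D`, normalised to unit length, consist of vectors `± w i ± w j`. -/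
def IsScaledFrame (w : ι → E) : Prop :=
  ∀ i j, ⟪w i, w j⟫ = if i = j then 1 / 2 else 0

theorem IsScaledFrame.map {w : ι → E} (hw : IsScaledFrame w) (g : E →ₗᵢ[ℝ] F) :
    IsScaledFrame (g ∘ w) := fun i j => by
  rw [Function.comp_apply, Function.comp_apply, g.inner_map_map, hw]

theorem IsScaledFrame.comp {κ : Type*} [DecidableEq κ] {w : ι → E} (hw : IsScaledFrame w)
    {o : κ → ι} (ho : Function.Injective o) : IsScaledFrame (w ∘ o) := fun i j => by
  simp only [Function.comp_apply, hw _ _, ho.eq_iff]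

theorem isScaledFrame_single [Fintype ι] :
    IsScaledFrame fun i : ι => √(1 / 2) • EuclideanSpace.single i (1 : ℝ) := fun i j => by
  rw [real_inner_smul_left, real_inner_smul_right, ← mul_assoc,
    Real.mul_self_sqrt one_half_pos.le,
    orthonormal_iff_ite.1 EuclideanSpace.orthonormal_single, mul_ite, mul_one, mul_zero]

variable {w : ι → E} (hw : IsScaledFrame w)
include hw

theorem IsScaledFrame.inner_linearCombination [Fintype ι] (z : ι → ℤ) (i : ι) :
    ⟪Fintype.linearCombination ℤ w z, w i⟫ = (z i : ℝ) / 2 := by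
  simp only [Fintype.linearCombination_apply, ← Int.cast_smul_eq_zsmul ℝ, sum_inner,
    real_inner_smul_left, hw _ _, mul_ite, mul_zero, Finset.sum_ite_eq', Finset.mem_univ, if_true]
  ring

theorem IsScaledFrame.inner_linearCombination_linearCombination [Fintype ι] (z z' : ι → ℤ) :
    ⟪Fintype.linearCombination ℤ w z, Fintype.linearCombination ℤ w z'⟫ =
      ((z ⬝ᵥ z' : ℤ) : ℝ) / 2 := by
  rw [Fintype.linearCombination_apply ℤ w z', inner_sum, dotProduct, Int.cast_sum, Finset.sum_div]
  refine Finset.sum_congr rfl fun i _ => ?_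
  rw [← Int.cast_smul_eq_zsmul ℝ, real_inner_smul_right, hw.inner_linearCombination]
  push_cast
  ring

theorem IsScaledFrame.linearIndependent : LinearIndependent ℝ w :=
  linearIndependent_of_ne_zero_of_inner_eq_zero
    (fun i hi => by simpa [hi] using hw i i) fun i j hij => by simp [hw i j, hij]

theorem IsScaledFrame.exists_eq_of_mem_unitVectors [Finite ι] {x : E}
    (hx : x ∈ unitVectors (rootLattice w)) :
    ∃ i j, i ≠ j ∧ ∃ s t : ℤ, s ^ 2 = 1 ∧ t ^ 2 = 1 ∧ x = s • w i + t • w j := by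
  have := Fintype.ofFinite ι
  obtain ⟨hx, hxx⟩ := mem_unitVectors_iff.1 hx
  obtain ⟨z, rfl⟩ : ∃ z, Fintype.linearCombination ℤ w z = x := by
    rwa [← LinearMap.mem_range, Fintype.range_linearCombination]
  rw [hw.inner_linearCombination_linearCombination, div_eq_one_iff_eq two_ne_zero] at hxx
  obtain ⟨i, j, hij, hi, hj, hk⟩ := exists_of_sum_sq_eq_two (z := z) (by
    simp only [sq]; exact_mod_cast hxx)
  refine ⟨i, j, hij, z i, z j, hi, hj, ?_⟩
  rw [Fintype.linearCombination_apply]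
  exact Fintype.sum_eq_add i j hij fun k hk' => by rw [hk k hk', zero_smul]

theorem IsScaledFrame.inner_smul_add_smul {i j : ι} (hij : i ≠ j) (s t s' t' : ℤ) :
    ⟪s • w i + t • w j, s' • w i + t' • w j⟫ = (s * s' + t * t' : ℝ) / 2 := by
  simp only [← Int.cast_smul_eq_zsmul ℝ, inner_add_left, inner_add_right, real_inner_smul_left,
    real_inner_smul_right, hw _ _, hij, hij.symm, if_true, if_false]
  ring

theorem IsScaledFrame.inner_smul_add_smul_self {i j : ι} (hij : i ≠ j) {s t : ℤ}
    (hs : s ^ 2 = 1) (ht : t ^ 2 = 1) :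
    ⟪s • w i + t • w j, s • w i + t • w j⟫ = 1 := by
  have hst : ((s ^ 2 + t ^ 2 : ℤ) : ℝ) / 2 = 1 := by rw [hs, ht]; norm_num
  rw [hw.inner_smul_add_smul hij, ← hst]
  push_cast
  ring

theorem IsScaledFrame.exists_inner_eq {y : E} (hy : y ∈ rootLattice w) (k : ι) :
    ∃ z : ℤ, ⟪y, w k⟫ = z / 2 := by
  induction hy using Submodule.span_induction with
  | mem y hy =>
    obtain ⟨i, rfl⟩ := hy
    exact ⟨if i = k then 1 else 0, by rw [hw]; split_ifs <;> norm_num⟩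
  | zero => exact ⟨0, by simp⟩
  | add x y _ _ hx hy =>
    obtain ⟨p, hp⟩ := hx
    obtain ⟨q, hq⟩ := hy
    exact ⟨p + q, by rw [inner_add_left, hp, hq, Int.cast_add, add_div]⟩
  | smul r y _ hy =>
    obtain ⟨p, hp⟩ := hy
    refine ⟨r * p, ?_⟩
    rw [← Int.cast_smul_eq_zsmul ℝ, real_inner_smul_left, hp, Int.cast_mul, mul_div_assoc]

/-- If `⟪w k, y⟫` and `⟪w l, y⟫` have the same sign, then `|⟪y, w k + w l⟫| ≥ 1`, so the equality
case of Cauchy–Schwarz applies. -/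
theorem IsScaledFrame.inner_mul_inner_nonpos {y : E} (hy : y ∈ unitVectors (rootLattice w))
    {k l : ι} (hkl : k ≠ l) (hne : y ∉ ({w k + w l, -(w k + w l)} : Set E)) :
    ⟪w k, y⟫ * ⟪y, w l⟫ ≤ 0 := by
  contrapose! hne
  obtain ⟨hyΛ, hy₁⟩ := hy
  have hu : ‖w k + w l‖ = 1 := by
    simpa using (mem_unitVectors_iff.2 ⟨Submodule.mem_top, hw.inner_smul_add_smul_self hkl
      (one_pow 2) (one_pow 2)⟩ : (1 : ℤ) • w k + (1 : ℤ) • w l ∈ unitVectors ⊤).2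
  obtain ⟨p, hp⟩ := hw.exists_inner_eq hyΛ k
  obtain ⟨q, hq⟩ := hw.exists_inner_eq hyΛ l
  rw [real_inner_comm, hp, hq] at hne
  have hle := abs_le.1 ((abs_real_inner_le_norm _ _).trans_eq (by rw [hy₁, hu, one_mul] :
    ‖y‖ * ‖w k + w l‖ = 1))
  have hinner : ⟪y, w k + w l⟫ = (p + q : ℝ) / 2 := by rw [inner_add_right, hp, hq, add_div]
  rw [hinner] at hle
  rcases pos_and_pos_or_neg_and_neg_of_mul_pos hne with ⟨hk, hl⟩ | ⟨hk, hl⟩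
  · have hk' : (1 : ℝ) ≤ p := by exact_mod_cast (div_pos_iff_of_pos_right two_pos).1 hk
    have hl' : (1 : ℝ) ≤ q := by exact_mod_cast (div_pos_iff_of_pos_right two_pos).1 hl
    exact Or.inl ((inner_eq_one_iff_of_norm_eq_one (𝕜 := ℝ) hy₁ hu).1 (by linarith))
  · have hk' : (p : ℝ) ≤ -1 := by
      have : p < 0 := by exact_mod_cast (by linarith : (p : ℝ) < 0)
      exact_mod_cast Int.le_sub_one_of_lt this
    have hl' : (q : ℝ) ≤ -1 := by
      have : q < 0 := by exact_mod_cast (by linarith : (q : ℝ) < 0)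
      exact_mod_cast Int.le_sub_one_of_lt this
    exact Or.inr ((inner_eq_neg_one_iff_of_norm_eq_one (𝕜 := ℝ) hy₁ hu).1 (by linarith))

end ScaledFrames

section TypeA

theorem sub_mem_of_forall_succ_sub_mem {R M : Type*} [Ring R] [AddCommGroup M] [Module R M] {n : ℕ}
    {q : Fin (n + 1) → M} {W : Submodule R M} (hW : ∀ i : Fin n, q i.succ - q i.castSucc ∈ W)
    (k l : Fin (n + 1)) : q k - q l ∈ W := by
  have sub_zero_mem : ∀ k, q k - q 0 ∈ W := fun k => by
    induction k using Fin.induction with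
    | zero => simp
    | succ k ih => simpa using add_mem (hW k) ih
  simpa using sub_mem (sub_zero_mem k) (sub_zero_mem l)

variable {n : ℕ} {E : Type*}

/-- The simple roots of type `A` on a scaled frame. -/
def aRoot [AddCommGroup E] (w : Fin (n + 1) → E) (i : Fin n) : E :=
  w i.succ - w i.castSucc

theorem sub_mem_rootLattice_aRoot [AddCommGroup E] (w : Fin (n + 1) → E) (i j : Fin (n + 1)) :
    w i - w j ∈ rootLattice (aRoot w) :=
  sub_mem_of_forall_succ_sub_mem (q := w) (W := rootLattice (aRoot w))
    (fun k => Submodule.subset_span (Set.mem_range_self k)) i j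

section ScaledFrame

variable [NormedAddCommGroup E] [InnerProductSpace ℝ E] {w : Fin (n + 1) → E}
  (hw : IsScaledFrame w)
include hw

/-- Partial sums of the frame are dual to the simple roots. -/
theorem IsScaledFrame.linearIndependent_aRoot : LinearIndependent ℝ (aRoot w) := by
  have hdual : ∀ k i : Fin n,
      ⟪(2 : ℝ) • ∑ j ∈ Finset.Ioi k.castSucc, w j, aRoot w i⟫ = if k = i then 1 else 0 := by
    intro k i
    simp only [aRoot, real_inner_smul_left, inner_sub_right, sum_inner, hw _ _,
      Finset.sum_ite_eq', Finset.mem_Ioi]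
    simp only [Fin.lt_def, Fin.val_castSucc, Fin.val_succ, Fin.ext_iff]
    split_ifs <;> first | omega | norm_num
  refine .of_pairwise_dual_eq_zero_one _
    (fun k => innerₛₗ ℝ ((2 : ℝ) • ∑ j ∈ Finset.Ioi k.castSucc, w j))
    (fun k i hki => ?_) fun k => ?_
  · exact (hdual k i).trans (if_neg hki)
  · exact (hdual k k).trans (if_pos rfl)

theorem IsScaledFrame.isSimpleSystem_aRoot : IsSimpleSystem (CartanMatrix.A n) (aRoot w) where
  linearIndependent := hw.linearIndependent_aRoot
  inner_eq i j := by
    simp only [aRoot, inner_sub_left, inner_sub_right, hw _ _, Fin.ext_iff, Fin.val_succ,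
      Fin.val_castSucc, CartanMatrix.A, Matrix.of_apply]
    split_ifs <;> first | omega | norm_num

/-- All vectors of the lattice are orthogonal to the sum of the frame, so the two signs of a root
`± w i ± w j` are opposite. -/
theorem IsScaledFrame.unitVectors_rootLattice_aRoot :
    unitVectors (rootLattice (aRoot w)) =
      (fun p : Fin (n + 1) × Fin (n + 1) => w p.1 - w p.2) ''
        (Finset.univ : Finset (Fin (n + 1))).offDiag := by
  have hle : rootLattice (aRoot w) ≤ rootLattice w := Submodule.span_le.2 (by
    rintro _ ⟨i, rfl⟩
    exact sub_mem (Submodule.subset_span ⟨_, rfl⟩) (Submodule.subset_span ⟨_, rfl⟩))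
  have inner_sum_eq : ∀ i, ⟪w i, ∑ j, w j⟫ = 1 / 2 := fun i => by
    simp only [inner_sum, hw _ _, Finset.sum_ite_eq, Finset.mem_univ, if_true]
  have orthogonal_sum : ∀ x ∈ rootLattice (aRoot w), ⟪x, ∑ j, w j⟫ = 0 := fun x hx => by
    induction hx using Submodule.span_induction with
    | mem x hx =>
      obtain ⟨i, rfl⟩ := hx
      rw [aRoot, inner_sub_left, inner_sum_eq, inner_sum_eq, sub_self]
    | zero => exact inner_zero_left _
    | add x y _ _ hx hy => rw [inner_add_left, hx, hy, add_zero]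
    | smul r x _ hx => rw [← Int.cast_smul_eq_zsmul ℝ, real_inner_smul_left, hx, mul_zero]
  ext x
  constructor
  · intro hx
    obtain ⟨i, j, hij, s, t, hs, -, rfl⟩ := hw.exists_eq_of_mem_unitVectors ⟨hle hx.1, hx.2⟩
    have hst := orthogonal_sum _ hx.1
    simp only [← Int.cast_smul_eq_zsmul ℝ, inner_add_left, real_inner_smul_left,
      inner_sum_eq] at hst
    obtain rfl : t = -s := by rify; linarith
    rcases sq_eq_one_iff.1 hs with rfl | rfl
    · exact ⟨(i, j), by simpa using hij, by simp [sub_eq_add_neg]⟩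
    · exact ⟨(j, i), by simpa using hij.symm, by simp [sub_eq_neg_add]⟩
  · rintro ⟨⟨i, j⟩, hij, rfl⟩
    refine mem_unitVectors_iff.2 ⟨sub_mem_rootLattice_aRoot w i j, ?_⟩
    simpa [sub_eq_add_neg] using hw.inner_smul_add_smul_self (s := 1) (t := -1) (i := i) (j := j)
      (by simpa using hij) rfl rfl

theorem IsScaledFrame.ncard_unitVectors_rootLattice_aRoot :
    (unitVectors (rootLattice (aRoot w))).ncard = n * (n + 1) := by
  have hinj : Set.InjOn (fun p : Fin (n + 1) × Fin (n + 1) => w p.1 - w p.2)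
      (Finset.univ : Finset (Fin (n + 1))).offDiag := by
    rintro ⟨i, j⟩ hij ⟨k, l⟩ - h
    have hij : i ≠ j := by simpa using hij
    simp only at h
    have hself : ⟪w i - w j, w k - w l⟫ = 1 := by
      simp only [← h, inner_sub_left, inner_sub_right, hw _ _, hij, hij.symm, if_true, if_false]
      norm_num
    simp only [inner_sub_left, inner_sub_right, hw _ _] at hself
    rw [Prod.mk.injEq]
    split_ifs at hself <;> first | exact ⟨‹_›, ‹_›⟩ | norm_num at hself
  rw [hw.unitVectors_rootLattice_aRoot, hinj.ncard_image, Set.ncard_coe_finset,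
    Finset.offDiag_card, Finset.card_univ, Fintype.card_fin, ← Nat.sub_one_mul, Nat.add_sub_cancel]

end ScaledFrame

theorem isConnectedCartan_A [NeZero n] : IsConnectedCartan (CartanMatrix.A n) := by
  refine .of_forall_exists_lt (fun i => by simp [CartanMatrix.A]) (CartanMatrix.A_isSymm n)
    Fin.val 0 fun i hi => ?_
  have hi₀ : i.val ≠ 0 := Fin.val_ne_zero_iff.2 hi
  refine ⟨⟨i - 1, by omega⟩, ?_, by simp only; omega⟩
  simp only [CartanMatrix.A, Matrix.of_apply, Fin.ext_iff]
  split_ifs <;> omega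

theorem exists_isRootLattice_A (n : ℕ) : ∃ Λ, IsRootLattice (CartanMatrix.A n) Λ :=
  isScaledFrame_single.isSimpleSystem_aRoot.exists_isRootLattice

theorem IsRootLattice.isMinimallyExtreme [NeZero n] {Λ : Submodule ℤ (EuclideanSpace ℝ (Fin n))}
    (hΛ : IsRootLattice (CartanMatrix.A n) Λ) : IsMinimallyExtreme (minimalConfiguration Λ) := by
  have hv := (isScaledFrame_single (ι := Fin (n + 1))).isSimpleSystem_aRoot
  obtain ⟨a, ha, hspan, rfl⟩ := hv.exists_of_isRootLattice hΛ
  obtain ⟨g, hg⟩ := ha.exists_linearIsometry hspan hv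
  rw [ha.minimalConfiguration_eq isConnectedCartan_A.diag]
  refine ⟨ha.isExtreme hspan isConnectedCartan_A, ?_⟩
  rw [finrank_euclideanSpace_fin, ← isScaledFrame_single.ncard_unitVectors_rootLattice_aRoot, ← hg,
    unitVectors_rootLattice_comp, Set.ncard_image_of_injective _ g.injective]

end TypeA

section TypeD

section Module

variable {m : ℕ} {E : Type*} [AddCommGroup E]

/-- The simple roots of type `D` on a scaled frame: `w i - w (i + 1)`, and the sum of the last two
frame vectors as the last root. -/
def dRoot (w : Fin (m + 2) → E) : Fin (m + 2) → E :=
  Fin.lastCases (w (Fin.last m).castSucc + w (Fin.last (m + 1)))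
    fun i : Fin (m + 1) => w i.castSucc - w i.succ

theorem dRoot_last (w : Fin (m + 2) → E) :
    dRoot w (Fin.last (m + 1)) = w (Fin.last m).castSucc + w (Fin.last (m + 1)) :=
  Fin.lastCases_last

theorem dRoot_castSucc (w : Fin (m + 2) → E) (i : Fin (m + 1)) :
    dRoot w i.castSucc = w i.castSucc - w i.succ :=
  Fin.lastCases_castSucc i

theorem comp_dRoot {F G : Type*} [AddCommGroup F] [FunLike G E F] [AddMonoidHomClass G E F] (g : G)
    (w : Fin (m + 2) → E) :
    g ∘ dRoot w = dRoot (g ∘ w) := by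
  funext i
  induction i using Fin.lastCases with
  | last => simp only [Function.comp_apply, dRoot_last, map_add]
  | cast i => simp only [Function.comp_apply, dRoot_castSucc, map_sub]

theorem sub_mem_rootLattice_dRoot (w : Fin (m + 2) → E) (i j : Fin (m + 2)) :
    w i - w j ∈ rootLattice (dRoot w) := by
  refine sub_mem_of_forall_succ_sub_mem (q := w) (W := rootLattice (dRoot w)) (fun i => ?_) i j
  rw [← neg_sub, ← dRoot_castSucc]
  exact neg_mem (Submodule.subset_span (Set.mem_range_self _))

theorem add_mem_rootLattice_dRoot (w : Fin (m + 2) → E) (i j : Fin (m + 2)) :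
    w i + w j ∈ rootLattice (dRoot w) := by
  have hlast : dRoot w (Fin.last (m + 1)) ∈ rootLattice (dRoot w) :=
    Submodule.subset_span (Set.mem_range_self _)
  rw [dRoot_last] at hlast
  convert add_mem (add_mem (sub_mem_rootLattice_dRoot w i (Fin.last m).castSucc)
    (sub_mem_rootLattice_dRoot w j (Fin.last (m + 1)))) hlast using 1
  abel

theorem smul_add_smul_mem_rootLattice_dRoot (w : Fin (m + 2) → E) (i j : Fin (m + 2)) {s t : ℤ}
    (hs : s ^ 2 = 1) (ht : t ^ 2 = 1) : s • w i + t • w j ∈ rootLattice (dRoot w) := by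
  rcases sq_eq_one_iff.1 hs with rfl | rfl <;> rcases sq_eq_one_iff.1 ht with rfl | rfl
  · simpa using add_mem_rootLattice_dRoot w i j
  · simpa [sub_eq_add_neg] using sub_mem_rootLattice_dRoot w i j
  · simpa [sub_eq_neg_add] using sub_mem_rootLattice_dRoot w j i
  · simpa [add_comm] using neg_mem (add_mem_rootLattice_dRoot w i j)

theorem span_dRoot_le (R : Type*) [Ring R] [Module R E] (w : Fin (m + 2) → E) :
    Submodule.span R (Set.range (dRoot w)) ≤ Submodule.span R (Set.range w) := by
  have hw : ∀ i, w i ∈ Submodule.span R (Set.range w) := fun i => Submodule.subset_span ⟨i, rfl⟩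
  refine Submodule.span_le.2 ?_
  rintro _ ⟨i, rfl⟩
  induction i using Fin.lastCases with
  | last => rw [dRoot_last]; exact add_mem (hw _) (hw _)
  | cast i => rw [dRoot_castSucc]; exact sub_mem (hw _) (hw _)

/-- Twice a frame vector lies in the lattice generated by the simple roots. -/
theorem span_dRoot [Module ℝ E] (w : Fin (m + 2) → E) :
    Submodule.span ℝ (Set.range (dRoot w)) = Submodule.span ℝ (Set.range w) := by
  refine (span_dRoot_le ℝ w).antisymm (Submodule.span_le.2 ?_)
  rintro _ ⟨i, rfl⟩
  have h : w i + w i ∈ Submodule.span ℝ (Set.range (dRoot w)) :=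
    Submodule.span_le_restrictScalars ℤ ℝ _ (add_mem_rootLattice_dRoot w i i)
  rw [← two_smul ℝ] at h
  exact (Submodule.smul_mem_iff _ two_ne_zero).1 h

end Module

theorem isConnectedCartan_D {n : ℕ} (hn : 3 ≤ n) : IsConnectedCartan (CartanMatrix.D n) := by
  refine .of_forall_exists_lt (CartanMatrix.D_diag n) (CartanMatrix.D_isSymm n) Fin.val
    ⟨0, by omega⟩ fun i hi => ?_
  have hi₀ : i.val ≠ 0 := fun h => hi (Fin.ext h)
  refine ⟨⟨if i.val + 1 = n then i - 2 else i - 1, by split_ifs <;> omega⟩, ?_, ?_⟩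
  · simp only [CartanMatrix.D, Matrix.of_apply, Fin.ext_iff]
    split_ifs <;> omega
  · simp only
    split_ifs <;> omega

variable {m : ℕ}

section ScaledFrame

variable {E : Type*} [NormedAddCommGroup E] [InnerProductSpace ℝ E]
  {w : Fin (m + 2) → E} (hw : IsScaledFrame w)
include hw

theorem IsScaledFrame.inner_dRoot_last_castSucc (i : Fin (m + 1)) :
    ⟪dRoot w (Fin.last (m + 1)), dRoot w i.castSucc⟫ =
      (CartanMatrix.D (m + 2) (Fin.last (m + 1)) i.castSucc : ℝ) / 2 := by
  have hi := i.isLt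
  simp only [dRoot_last, dRoot_castSucc, inner_add_left, inner_sub_right, hw _ _,
    CartanMatrix.D, Matrix.of_apply, Fin.ext_iff, Fin.val_last, Fin.val_castSucc, Fin.val_succ,
    or_true, and_true]
  split_ifs <;> first | omega | norm_num

theorem IsScaledFrame.inner_dRoot_castSucc_castSucc (i j : Fin (m + 1)) :
    ⟪dRoot w i.castSucc, dRoot w j.castSucc⟫ =
      (CartanMatrix.D (m + 2) i.castSucc j.castSucc : ℝ) / 2 := by
  have hD : CartanMatrix.D (m + 2) i.castSucc j.castSucc = if i.val = j.val then 2 else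
      if i.val + 1 = j.val ∨ j.val + 1 = i.val then -1 else 0 := by
    simp only [CartanMatrix.D, Matrix.of_apply, Fin.ext_iff, Fin.val_castSucc]
    split_ifs <;> first | rfl | omega
  rw [hD]
  simp only [dRoot_castSucc, inner_sub_right, inner_sub_left, hw _ _, Fin.ext_iff,
    Fin.val_castSucc, Fin.val_succ]
  split_ifs <;> first | omega | norm_num

theorem IsScaledFrame.inner_dRoot (i j : Fin (m + 2)) :
    ⟪dRoot w i, dRoot w j⟫ = (CartanMatrix.D (m + 2) i j : ℝ) / 2 := by
  induction i using Fin.lastCases with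
  | last =>
    induction j using Fin.lastCases with
    | last =>
      rw [dRoot_last, ← one_smul ℤ (w _), ← one_smul ℤ (w (Fin.last (m + 1))),
        hw.inner_smul_add_smul_self (by simp [Fin.ext_iff]) (one_pow 2) (one_pow 2),
        CartanMatrix.D_diag]
      norm_num
    | cast j => exact hw.inner_dRoot_last_castSucc j
  | cast i =>
    induction j using Fin.lastCases with
    | last =>
      rw [real_inner_comm, hw.inner_dRoot_last_castSucc, (CartanMatrix.D_isSymm (m + 2)).apply]
    | cast j => exact hw.inner_dRoot_castSucc_castSucc i j

theorem IsScaledFrame.isSimpleSystem_dRoot :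
    IsSimpleSystem (CartanMatrix.D (m + 2)) (dRoot w) where
  linearIndependent := by
    rw [linearIndependent_iff_card_eq_finrank_span, Set.finrank, span_dRoot]
    exact (finrank_span_eq_card hw.linearIndependent).symm
  inner_eq := hw.inner_dRoot

theorem IsScaledFrame.mem_unitVectors_rootLattice_dRoot_iff {x : E} :
    x ∈ unitVectors (rootLattice (dRoot w)) ↔
      ∃ i j, i ≠ j ∧ ∃ s t : ℤ, s ^ 2 = 1 ∧ t ^ 2 = 1 ∧ x = s • w i + t • w j := by
  refine ⟨fun hx => hw.exists_eq_of_mem_unitVectors ⟨span_dRoot_le ℤ w hx.1, hx.2⟩, ?_⟩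
  rintro ⟨i, j, hij, s, t, hs, ht, rfl⟩
  exact mem_unitVectors_iff.2 ⟨smul_add_smul_mem_rootLattice_dRoot w i j hs ht,
    hw.inner_smul_add_smul_self hij hs ht⟩

theorem IsScaledFrame.isHalvedFrame_rootLattice_dRoot {i j k l : Fin (m + 2)} (hij : i ≠ j)
    (hk : k ≠ i ∧ k ≠ j) (hl : l ≠ i ∧ l ≠ j) (hkl : k ≠ l) {s t : ℤ} (hs : s ^ 2 = 1)
    (ht : t ^ 2 = 1) :
    IsHalvedFrame (rootLattice (dRoot w)) (rootLattice (dRoot w))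
      ![s • w i + t • w j, s • w i + (-t) • w j, (1 : ℤ) • w k + (1 : ℤ) • w l,
        (1 : ℤ) • w k + (-1 : ℤ) • w l] := by
  have ht' : (-t) ^ 2 = 1 := by rw [neg_sq, ht]
  have hs' : (s : ℝ) ^ 2 = 1 := by exact_mod_cast hs
  have htr : (t : ℝ) ^ 2 = 1 := by exact_mod_cast ht
  refine ⟨?_, ?_, ?_⟩
  · rw [orthonormal_iff_ite]
    intro p q
    fin_cases p <;> fin_cases q
    all_goals
      simp only [Fin.zero_eta, Fin.mk_one, Fin.reduceFinMk, Matrix.cons_val, Fin.reduceEq,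
        ← Int.cast_smul_eq_zsmul ℝ, inner_add_left, inner_add_right, real_inner_smul_left,
        real_inner_smul_right, hw _ _, hij, hij.symm, hk.1, hk.2, hk.1.symm, hk.2.symm, hl.1, hl.2,
        hl.1.symm, hl.2.symm, hkl, hkl.symm, if_true, if_false]
      push_cast
      linarith
  · intro p
    fin_cases p
    · exact smul_add_smul_mem_rootLattice_dRoot w i j hs ht
    · exact smul_add_smul_mem_rootLattice_dRoot w i j hs ht'
    · exact smul_add_smul_mem_rootLattice_dRoot w k l (one_pow 2) (one_pow 2)
    · exact smul_add_smul_mem_rootLattice_dRoot w k l (one_pow 2) neg_one_sq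
  · convert smul_add_smul_mem_rootLattice_dRoot w i k hs (one_pow 2) using 1
    simp only [Fin.sum_univ_four, Matrix.cons_val, ← Int.cast_smul_eq_zsmul ℝ]
    push_cast
    module

theorem IsScaledFrame.isSemiEutactic_diff (hm : 2 ≤ m)
    (hspan : Submodule.span ℝ (Set.range w) = ⊤) {x : E}
    (hx : x ∈ unitVectors (rootLattice (dRoot w))) :
    IsSemiEutactic (unitVectors (rootLattice (dRoot w)) \ {x, -x}) := by
  obtain ⟨i, j, hij, s, t, hs, ht, rfl⟩ := hw.mem_unitVectors_rootLattice_dRoot_iff.1 hx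
  obtain ⟨k, hk, l, hl, hkl⟩ : ∃ k ∈ ({i, j}ᶜ : Finset (Fin (m + 2))), ∃ l ∈ ({i, j}ᶜ : Finset _),
      k ≠ l := Finset.one_lt_card.1 (by
    rw [Finset.card_compl, Finset.card_pair hij, Fintype.card_fin]; omega)
  simp only [Finset.mem_compl, Finset.mem_insert, Finset.mem_singleton, not_or] at hk hl
  have hf := hw.isHalvedFrame_rootLattice_dRoot hij hk hl hkl hs ht
  have hdRoot : Submodule.span ℝ (Set.range (dRoot w)) = ⊤ := span_dRoot w ▸ hspan
  have hD := hw.isSimpleSystem_dRoot.isStronglyEutactic hdRoot (isConnectedCartan_D (by omega))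
  exact (hf.isExchange le_rfl).isSemiEutactic hD (hD.1.diff_pair _)

/-- Among the roots, only `± (w k + w l)` contribute positively to the `(k, l)` entry of a
combination of projections, and that entry vanishes for the identity. -/
theorem IsScaledFrame.not_isEutactic_diff {k l : Fin (m + 2)} (hkl : k ≠ l) :
    ¬ IsEutactic (unitVectors (rootLattice (dRoot w)) \ {w k + w l, -(w k + w l)}) := by
  rintro ⟨hT, v, ⟨-, hv⟩, hpos⟩
  have hmem : w k - w l ∈ unitVectors (rootLattice (dRoot w)) \ {w k + w l, -(w k + w l)} := by
    refine ⟨hw.mem_unitVectors_rootLattice_dRoot_iff.2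
      ⟨k, l, hkl, 1, -1, one_pow 2, neg_one_sq, by module⟩, ?_⟩
    rintro (h | h)
    · have h := congrArg (fun y => ⟪y, w l⟫) h
      simp only [inner_sub_left, inner_add_left, hw _ _, hkl, if_true, if_false] at h
      norm_num at h
    · have h := congrArg (fun y => ⟪y, w k⟫) (Set.mem_singleton_iff.1 h)
      simp only [inner_sub_left, inner_neg_left, inner_add_left, hw _ _, hkl.symm, if_true,
        if_false] at h
      norm_num at h
  have hentry := congrArg (fun Q : E →ₗ[ℝ] E => ⟪Q (w k), w l⟫) hv
  simp only [finsum_mem_eq_finite_toFinset_sum _ hT.finite, LinearMap.id_apply, hw _ _, hkl,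
    if_false, LinearMap.sum_apply, LinearMap.smul_apply, proj_apply, sum_inner,
    real_inner_smul_left] at hentry
  refine hentry.not_gt (Finset.sum_neg' (fun y hy => ?_)
    ⟨w k - w l, hT.finite.mem_toFinset.2 hmem, mul_neg_of_pos_of_neg (hpos _ hmem) ?_⟩)
  · obtain ⟨hy, hne⟩ := hT.finite.mem_toFinset.1 hy
    exact mul_nonpos_of_nonneg_of_nonpos (hpos y ⟨hy, hne⟩).le
      (hw.inner_mul_inner_nonpos ⟨span_dRoot_le ℤ w hy.1, hy.2⟩ hkl hne)
  · simp only [inner_sub_left, inner_sub_right, hw _ _, hkl, if_true, if_false]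
    norm_num

end ScaledFrame

theorem exists_isRootLattice_D {n : ℕ} (hn : 2 ≤ n) :
    ∃ Λ, IsRootLattice (CartanMatrix.D n) Λ := by
  obtain ⟨m, rfl⟩ := Nat.exists_eq_add_of_le' hn
  exact isScaledFrame_single.isSimpleSystem_dRoot.exists_isRootLattice

theorem IsRootLattice.exists_isScaledFrame
    {Λ : Submodule ℤ (EuclideanSpace ℝ (Fin (m + 2)))}
    (hΛ : IsRootLattice (CartanMatrix.D (m + 2)) Λ) :
    ∃ w : Fin (m + 2) → EuclideanSpace ℝ (Fin (m + 2)), IsScaledFrame w ∧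
      Submodule.span ℝ (Set.range w) = ⊤ ∧ Λ = rootLattice (dRoot w) := by
  obtain ⟨w, hw⟩ : ∃ w : Fin (m + 2) → EuclideanSpace ℝ (Fin (m + 2)), IsScaledFrame w :=
    ⟨_, isScaledFrame_single⟩
  obtain ⟨a, ha, hspan, rfl⟩ := hw.isSimpleSystem_dRoot.exists_of_isRootLattice hΛ
  have hspan_dRoot := hw.isSimpleSystem_dRoot.linearIndependent
    |>.span_eq_top_of_card_eq_finrank' (by simp)
  obtain ⟨g, rfl⟩ := hw.isSimpleSystem_dRoot.exists_linearIsometry hspan_dRoot ha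
  have hg : g ∘ dRoot w = dRoot (g ∘ w) := comp_dRoot g w
  refine ⟨g ∘ w, hw.map g, ?_, congrArg rootLattice hg⟩
  rw [← span_dRoot, ← hg, hspan]

theorem IsRootLattice.isRedundantlySemiEutactic {n : ℕ} (hn : 4 ≤ n)
    {Λ : Submodule ℤ (EuclideanSpace ℝ (Fin n))} (hΛ : IsRootLattice (CartanMatrix.D n) Λ) :
    IsRedundantlySemiEutactic (minimalConfiguration Λ) := by
  obtain ⟨m, rfl⟩ : ∃ m, n = m + 2 := ⟨n - 2, by omega⟩
  obtain ⟨w, hw, hspan, rfl⟩ := hΛ.exists_isScaledFrame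
  rw [hw.isSimpleSystem_dRoot.minimalConfiguration_eq (CartanMatrix.D_diag _)]
  exact ⟨hw.isSimpleSystem_dRoot.isExtreme (span_dRoot w ▸ hspan) (isConnectedCartan_D (by omega)),
    fun x hx => hw.isSemiEutactic_diff (by omega) hspan hx⟩

theorem IsRootLattice.not_isRedundantlyExtreme {n : ℕ} (hn : 2 ≤ n)
    {Λ : Submodule ℤ (EuclideanSpace ℝ (Fin n))} (hΛ : IsRootLattice (CartanMatrix.D n) Λ) :
    ¬ IsRedundantlyExtreme (minimalConfiguration Λ) := by
  obtain ⟨m, rfl⟩ := Nat.exists_eq_add_of_le' hn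
  obtain ⟨w, hw, -, rfl⟩ := hΛ.exists_isScaledFrame
  rw [hw.isSimpleSystem_dRoot.minimalConfiguration_eq (CartanMatrix.D_diag _)]
  intro h
  refine hw.not_isEutactic_diff (zero_ne_one (α := Fin (m + 2))) (h.2 (w 0 + w 1) ?_).2
  exact hw.mem_unitVectors_rootLattice_dRoot_iff.2
    ⟨0, 1, zero_ne_one, 1, 1, one_pow 2, one_pow 2, by module⟩

end TypeD

section TypeE

variable {ι E F : Type*} [NormedAddCommGroup E] [InnerProductSpace ℝ E]
  [NormedAddCommGroup F] [InnerProductSpace ℝ F]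

theorem HasFramePair.mono {Λ₀ Λ₀' Λ Λ' : Submodule ℤ E} {x : E} (h : HasFramePair Λ₀ Λ x)
    (hle₀ : Λ₀ ≤ Λ₀') (hle : Λ ≤ Λ') : HasFramePair Λ₀' Λ' x := by
  obtain ⟨f, f', hf, hf', hx⟩ := h
  exact ⟨f, f', ⟨hf.orthonormal, fun i => hle₀ (hf.mem i), hle hf.half_sum_mem⟩,
    ⟨hf'.orthonormal, fun i => hle₀ (hf'.mem i), hle hf'.half_sum_mem⟩, hx⟩

variable {C : Matrix ι ι ℤ} {a : ι → E}

theorem IsSimpleSystem.comp (ha : IsSimpleSystem C a) {κ : Type*} {f : κ → ι}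
    (hf : Function.Injective f) : IsSimpleSystem (C.submatrix f f) (a ∘ f) where
  linearIndependent := ha.linearIndependent.comp f hf
  inner_eq i j := ha.inner_eq (f i) (f j)

variable [Fintype ι]

theorem IsSimpleSystem.isHalvedFrame (ha : IsSimpleSystem C a) {z : Fin 4 → ι → ℤ} {s : ι → ℤ}
    (hz : ∀ k l, z k ⬝ᵥ C.mulVec (z l) = if k = l then 2 else 0) (hs : ∑ k, z k = s + s) :
    IsHalvedFrame (rootLattice a) (rootLattice a) fun k => Fintype.linearCombination ℤ a (z k) := by
  have mem_rootLattice : ∀ c, Fintype.linearCombination ℤ a c ∈ rootLattice a := fun c =>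
    (Fintype.range_linearCombination ℤ a).le (LinearMap.mem_range_self _ c)
  refine ⟨orthonormal_iff_ite.2 fun k l => ?_, fun k => mem_rootLattice _, ?_⟩
  · rw [ha.inner_linearCombination, hz]
    split_ifs <;> norm_num
  · rw [← map_sum, hs, map_add, ← two_smul ℝ, smul_smul, one_div_mul_cancel two_ne_zero, one_smul]
    exact mem_rootLattice s

theorem IsSimpleSystem.hasFramePair (ha : IsSimpleSystem C a) {z z' : Fin 4 → ι → ℤ}
    {s s' : ι → ℤ} (hz : ∀ k l, z k ⬝ᵥ C.mulVec (z l) = if k = l then 2 else 0)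
    (hs : ∑ k, z k = s + s) (hz' : ∀ k l, z' k ⬝ᵥ C.mulVec (z' l) = if k = l then 2 else 0)
    (hs' : ∑ k, z' k = s' + s') (h₀ : z' 0 = z 0)
    (hdisj : ∀ i j, z i = z' j ∨ z i = -z' j → i = 0) :
    HasFramePair (rootLattice a) (rootLattice a) (Fintype.linearCombination ℤ a (z 0)) := by
  have hinj : Function.Injective (Fintype.linearCombination ℤ a) :=
    (LinearIndependent.restrict_scalars' ℤ ha.linearIndependent).fintypeLinearCombination_injective
  refine ⟨_, _, ha.isHalvedFrame hz hs, ha.isHalvedFrame hz' hs', rfl, by rw [h₀], ?_⟩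
  rintro y ⟨⟨i, rfl⟩ | ⟨i, rfl⟩, ⟨j, hj⟩ | ⟨j, hj⟩⟩
  · obtain rfl := hdisj i j (Or.inl (hinj hj.symm))
    exact Or.inl rfl
  · obtain rfl := hdisj i j (Or.inr (hinj (by rw [map_neg]; exact hj.symm)))
    exact Or.inl rfl
  · obtain rfl := hdisj i j (Or.inr (hinj (by rw [map_neg]; exact neg_eq_iff_eq_neg.1 hj.symm)))
    exact Or.inr rfl
  · obtain rfl := hdisj i j (Or.inl (hinj (neg_injective hj.symm)))
    exact Or.inr rfl

theorem IsSimpleSystem.hasFramePair_E₆ {a : Fin 6 → E} (ha : IsSimpleSystem CartanMatrix.E₆ a) :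
    HasFramePair (rootLattice a) (rootLattice a) (a 0) := by
  have h := ha.hasFramePair
    (z := ![![1, 0, 0, 0, 0, 0], ![0, 0, 0, 0, 1, 1], ![0, 1, 0, 0, 0, 0], ![1, 1, 2, 2, 1, 1]])
    (z' := ![![1, 0, 0, 0, 0, 0], ![0, 1, 0, 1, 1, 0], ![0, 0, 0, 1, 0, 0], ![1, 1, 2, 2, 1, 0]])
    (s := ![1, 1, 1, 1, 1, 1]) (s' := ![1, 1, 1, 2, 1, 0]) (by decide +kernel) (by decide +kernel)
    (by decide +kernel) (by decide +kernel) (by decide +kernel) (by decide +kernel)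
  simpa [Fintype.linearCombination_apply, Fin.sum_univ_succ] using h

theorem IsScaledFrame.isSimpleSystem [DecidableEq ι] {κ : Type*} [Fintype κ] [DecidableEq κ]
    {w : κ → E} (hw : IsScaledFrame w) {V : ι → κ → ℤ}
    (hV : ∀ i j, V i ⬝ᵥ V j = 4 * C i j) (hC : C.det ≠ 0) :
    IsSimpleSystem C fun i => (1 / 2 : ℝ) • Fintype.linearCombination ℤ w (V i) := by
  have inner_eq : ∀ i j, ⟪(1 / 2 : ℝ) • Fintype.linearCombination ℤ w (V i),
      (1 / 2 : ℝ) • Fintype.linearCombination ℤ w (V j)⟫ = (C i j : ℝ) / 2 := fun i j => by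
    rw [real_inner_smul_left, real_inner_smul_right, hw.inner_linearCombination_linearCombination,
      hV]
    push_cast
    ring
  refine ⟨Matrix.linearIndependent_of_det_gram_ne_zero ?_, inner_eq⟩
  have hgram : Matrix.gram ℝ (fun i => (1 / 2 : ℝ) • Fintype.linearCombination ℤ w (V i)) =
      (1 / 2 : ℝ) • (Int.castRingHom ℝ).mapMatrix C := by
    ext i j
    rw [Matrix.gram_apply, inner_eq]
    simp [div_eq_inv_mul]
  rw [hgram, Matrix.det_smul, ← RingHom.map_det]
  simpa using hC

/-- The simple roots of `E₈` in the coordinates of Bourbaki, multiplied by `2`. -/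
def doubledRootE₈ : Fin 8 → Fin 8 → ℤ :=
  ![![1, -1, -1, -1, -1, -1, -1, 1],
    ![2, 2, 0, 0, 0, 0, 0, 0],
    ![-2, 2, 0, 0, 0, 0, 0, 0],
    ![0, -2, 2, 0, 0, 0, 0, 0],
    ![0, 0, -2, 2, 0, 0, 0, 0],
    ![0, 0, 0, -2, 2, 0, 0, 0],
    ![0, 0, 0, 0, -2, 2, 0, 0],
    ![0, 0, 0, 0, 0, -2, 2, 0]]

theorem exists_isSimpleSystem_E₈ :
    ∃ v : Fin 8 → EuclideanSpace ℝ (Fin 8), IsSimpleSystem CartanMatrix.E₈ v :=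
  ⟨_, isScaledFrame_single.isSimpleSystem (V := doubledRootE₈)
    (by decide +kernel) (by rw [CartanMatrix.E₈_det]; exact one_ne_zero)⟩

theorem exists_isSimpleSystem_E₇ :
    ∃ v : Fin 7 → EuclideanSpace ℝ (Fin 8), IsSimpleSystem CartanMatrix.E₇ v := by
  obtain ⟨v, hv⟩ := exists_isSimpleSystem_E₈
  have h : CartanMatrix.E₇ = CartanMatrix.E₈.submatrix Fin.castSucc Fin.castSucc := by
    decide +kernel
  exact ⟨_, h ▸ hv.comp (Fin.castSucc_injective 7)⟩

theorem exists_isSimpleSystem_E₆ :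
    ∃ v : Fin 6 → EuclideanSpace ℝ (Fin 8), IsSimpleSystem CartanMatrix.E₆ v := by
  obtain ⟨v, hv⟩ := exists_isSimpleSystem_E₇
  have h : CartanMatrix.E₆ = CartanMatrix.E₇.submatrix Fin.castSucc Fin.castSucc := by
    decide +kernel
  exact ⟨_, h ▸ hv.comp (Fin.castSucc_injective 6)⟩

theorem IsSimpleSystem.isRedundantlyExtreme_minimalConfiguration {n : ℕ}
    {C : Matrix (Fin n) (Fin n) ℤ} {v : Fin n → F} (hv : IsSimpleSystem C v)
    (hC : IsConnectedCartan C) {f : Fin 6 → Fin n} (hf : Function.Injective f)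
    (hE₆ : C.submatrix f f = CartanMatrix.E₆) {Λ : Submodule ℤ (EuclideanSpace ℝ (Fin n))}
    (hΛ : IsRootLattice C Λ) : IsRedundantlyExtreme (minimalConfiguration Λ) := by
  obtain ⟨a, ha, hspan, rfl⟩ := hv.exists_of_isRootLattice hΛ
  have : Nonempty (Fin n) := ⟨f 0⟩
  have hle : rootLattice (a ∘ f) ≤ rootLattice a :=
    Submodule.span_mono (Set.range_comp_subset_range f a)
  rw [ha.minimalConfiguration_eq hC.diag]
  exact ha.isRedundantlyExtreme hspan hC ((hE₆ ▸ ha.comp hf).hasFramePair_E₆.mono hle hle)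

theorem isConnectedCartan_E₆ : IsConnectedCartan CartanMatrix.E₆ :=
  .of_forall_exists_lt CartanMatrix.E₆_diag CartanMatrix.E₆_isSymm (Fin.rev · |>.val) 5
    fun i hi => ⟨![2, 3, 3, 4, 5, 5] i, by decide +kernel +revert⟩

theorem isConnectedCartan_E₇ : IsConnectedCartan CartanMatrix.E₇ :=
  .of_forall_exists_lt CartanMatrix.E₇_diag CartanMatrix.E₇_isSymm (Fin.rev · |>.val) 6
    fun i hi => ⟨![2, 3, 3, 4, 5, 6, 6] i, by decide +kernel +revert⟩

theorem isConnectedCartan_E₈ : IsConnectedCartan CartanMatrix.E₈ :=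
  .of_forall_exists_lt CartanMatrix.E₈_diag CartanMatrix.E₈_isSymm (Fin.rev · |>.val) 7
    fun i hi => ⟨![2, 3, 3, 4, 5, 6, 7, 7] i, by decide +kernel +revert⟩

theorem isRedundantlyExtreme_E₆ {Λ : Submodule ℤ (EuclideanSpace ℝ (Fin 6))}
    (hΛ : IsRootLattice CartanMatrix.E₆ Λ) : IsRedundantlyExtreme (minimalConfiguration Λ) := by
  obtain ⟨v, hv⟩ := exists_isSimpleSystem_E₆
  exact hv.isRedundantlyExtreme_minimalConfiguration isConnectedCartan_E₆ Function.injective_id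
    rfl hΛ

theorem isRedundantlyExtreme_E₇ {Λ : Submodule ℤ (EuclideanSpace ℝ (Fin 7))}
    (hΛ : IsRootLattice CartanMatrix.E₇ Λ) : IsRedundantlyExtreme (minimalConfiguration Λ) := by
  obtain ⟨v, hv⟩ := exists_isSimpleSystem_E₇
  exact hv.isRedundantlyExtreme_minimalConfiguration isConnectedCartan_E₇
    (Fin.castLE_injective (Nat.le_succ 6)) (by decide +kernel) hΛ

theorem isRedundantlyExtreme_E₈ {Λ : Submodule ℤ (EuclideanSpace ℝ (Fin 8))}
    (hΛ : IsRootLattice CartanMatrix.E₈ Λ) : IsRedundantlyExtreme (minimalConfiguration Λ) := by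
  obtain ⟨v, hv⟩ := exists_isSimpleSystem_E₈
  exact hv.isRedundantlyExtreme_minimalConfiguration isConnectedCartan_E₈
    (Fin.castLE_injective (Nat.le_add_right 6 2)) (by decide +kernel) hΛ

end TypeE

section Golay

/-- The binary word of length `24` whose `k`-th entry is the `k`-th lowest binary digit of `N`. With
words encoded by natural numbers, statements about all `2¹²` codewords are decided by evaluation. -/
def bitVector (N : ℕ) : Fin 24 → ZMod 2 := fun k => if N.testBit k then 1 else 0

theorem bitVector_zero : bitVector 0 = 0 := by
  funext k
  simp [bitVector]

theorem bitVector_xor (M N : ℕ) : bitVector (M ^^^ N) = bitVector M + bitVector N := by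
  funext k
  simp only [bitVector, Nat.testBit_xor, Pi.add_apply]
  cases M.testBit k <;> cases N.testBit k <;> decide

theorem hammingNorm_bitVector (N : ℕ) :
    hammingNorm (bitVector N) = Nat.count (fun k => N.testBit k) 24 := by
  simp only [hammingNorm, bitVector, ne_eq, ite_eq_right_iff, one_ne_zero, imp_false, not_not]
  rw [Nat.count_eq_card_filter_range, Finset.card_filter, Finset.card_filter,
    Fin.sum_univ_eq_sum_range fun k => if N.testBit k then 1 else 0]

/-- The list of all bitwise sums of sublists of a list of binary words encoded by numbers, that is,
the code generated by these words. -/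
def xorSpan : List ℕ → List ℕ
  | [] => [0]
  | r :: rs => xorSpan rs ++ (xorSpan rs).map (r ^^^ ·)

theorem mem_span_bitVector_iff (l : List ℕ) (c : Fin 24 → ZMod 2) :
    c ∈ Submodule.span (ZMod 2) (bitVector '' {r | r ∈ l}) ↔ ∃ N ∈ xorSpan l, bitVector N = c := by
  induction l generalizing c with
  | nil => simp [xorSpan, bitVector_zero, eq_comm]
  | cons r rs ih =>
    have hset : {s | s ∈ r :: rs} = insert r {s | s ∈ rs} := by ext; simp
    simp only [hset, Set.image_insert_eq, Submodule.mem_span_insert, ih, xorSpan, List.mem_append,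
      List.mem_map]
    constructor
    · rintro ⟨a, _, ⟨N, hN, rfl⟩, rfl⟩
      obtain rfl | rfl : a = 0 ∨ a = 1 := by decide +revert
      · exact ⟨N, Or.inl hN, by simp⟩
      · exact ⟨r ^^^ N, Or.inr ⟨N, hN, rfl⟩, by rw [bitVector_xor, one_smul]⟩
    · rintro ⟨_, hN | ⟨N, hN, rfl⟩, rfl⟩
      · exact ⟨0, _, ⟨_, hN, rfl⟩, by simp⟩
      · exact ⟨1, _, ⟨N, hN, rfl⟩, by rw [bitVector_xor, one_smul]⟩

/-- The `k`-th cyclic shift of the generator polynomial of the Golay code, with a parity bit,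
encoded by a number as in `bitVector`. -/
def shiftWord (k : ℕ) : ℕ :=
  ([0, 2, 4, 5, 6, 10, 11].map fun d => 2 ^ ((d + k) % 23)).sum + 2 ^ 23

/-- All sums of the six rows `k, …, k + 5` of the generator matrix of the Golay code, encoded by
numbers as in `bitVector`. -/
def rowSums (k : ℕ) : List ℕ := xorSpan ((List.range' k 6).map shiftWord)

theorem mem_golayCode_iff (c : Fin 24 → ZMod 2) :
    c ∈ golayCode ↔ ∃ M ∈ rowSums 0, ∃ N ∈ rowSums 6, bitVector (M ^^^ N) = c := by
  have hrow : ∀ j : Fin 12, golayRow j = bitVector (shiftWord j) := by decide +kernel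
  have hrange : Set.range golayRow = bitVector '' {r | r ∈ (List.range' 0 6).map shiftWord} ∪
      bitVector '' {r | r ∈ (List.range' 6 6).map shiftWord} := by
    ext v
    simp only [Set.mem_range, hrow, Fin.exists_iff, Set.mem_union, Set.mem_image,
      Set.mem_ofPred_eq, List.mem_map, List.mem_range'_1, exists_exists_and_eq_and]
    grind
  simp only [golayCode, hrange, Submodule.span_union, Submodule.mem_sup, mem_span_bitVector_iff,
    bitVector_xor, exists_exists_and_eq_and, rowSums]

/-- Splitting the `2¹²` words as `2⁶` times `2⁶` keeps the recursion of the evaluation shallow. -/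
theorem count_testBit_of_mem_rowSums : ∀ M ∈ rowSums 0, ∀ N ∈ rowSums 6,
    4 ∣ Nat.count (fun k => (M ^^^ N).testBit k) 24 ∧
      (M ^^^ N = 0 ∨ 8 ≤ Nat.count (fun k => (M ^^^ N).testBit k) 24) := by
  decide +kernel

theorem four_dvd_hammingNorm {c : Fin 24 → ZMod 2} (hc : c ∈ golayCode) : 4 ∣ hammingNorm c := by
  obtain ⟨M, hM, N, hN, rfl⟩ := (mem_golayCode_iff c).1 hc
  rw [hammingNorm_bitVector]
  exact (count_testBit_of_mem_rowSums M hM N hN).1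

theorem eight_le_hammingNorm {c : Fin 24 → ZMod 2} (hc : c ∈ golayCode) (h0 : c ≠ 0) :
    8 ≤ hammingNorm c := by
  obtain ⟨M, hM, N, hN, rfl⟩ := (mem_golayCode_iff c).1 hc
  rw [hammingNorm_bitVector]
  refine (count_testBit_of_mem_rowSums M hM N hN).2.resolve_left fun h => h0 ?_
  rw [h, bitVector_zero]

theorem bitVector_shiftWord_mem_golayCode (k : Fin 23) : bitVector (shiftWord k) ∈ golayCode := by
  have h : ∀ k : Fin 23, ∃ M ∈ rowSums 0, ∃ N ∈ rowSums 6, M ^^^ N = shiftWord k := by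
    decide +kernel
  obtain ⟨M, hM, N, hN, hk⟩ := h k
  exact (mem_golayCode_iff _).2 ⟨M, hM, N, hN, congrArg bitVector hk⟩

theorem hammingNorm_bitVector_shiftWord :
    ∀ k : Fin 23, hammingNorm (bitVector (shiftWord k)) = 8 := by
  decide +kernel

/-- The cyclic shifts suffice because every residue mod `23` is a difference of two exponents of the
generator polynomial. -/
theorem exists_testBit_shiftWord : ∀ i j : Fin 24, ∃ k : Fin 23,
    (shiftWord k).testBit i ∧ (shiftWord k).testBit j := by
  decide +kernel

theorem exists_mem_golayCode_hammingNorm_eq_eight (i j : Fin 24) :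
    ∃ c ∈ golayCode, hammingNorm c = 8 ∧ c i ≠ 0 ∧ c j ≠ 0 := by
  obtain ⟨k, hi, hj⟩ := exists_testBit_shiftWord i j
  exact ⟨_, bitVector_shiftWord_mem_golayCode k, hammingNorm_bitVector_shiftWord k,
    by simp [bitVector, hi], by simp [bitVector, hj]⟩

theorem exists_injective_range_eq {α : Type*} {s : Finset α} {n : ℕ} (hs : s.card = n + 2)
    {i j : α} (hi : i ∈ s) (hj : j ∈ s) (hij : i ≠ j) :
    ∃ o : Fin (n + 2) → α, Function.Injective o ∧ o 0 = i ∧ o 1 = j ∧ Set.range o = s := by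
  classical
  have hcard : ((s.erase i).erase j).card = n := by
    rw [Finset.card_erase_of_mem (Finset.mem_erase.2 ⟨hij.symm, hj⟩), Finset.card_erase_of_mem hi,
      hs]
    rfl
  let e : Fin n → α := Subtype.val ∘ (Finset.equivFinOfCardEq hcard).symm
  have he : Function.Injective e := Subtype.val_injective.comp (Equiv.injective _)
  have hrange : Set.range e = ((s.erase i).erase j : Finset α) := by
    rw [(Finset.equivFinOfCardEq hcard).symm.surjective.range_comp, Subtype.range_coe]
  refine ⟨Fin.cons i (Fin.cons j e : Fin (n + 1) → α), ?_, rfl, rfl, ?_⟩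
  · simp [Fin.cons_injective_iff, Fin.range_cons, he, hrange, hij]
  · rw [Fin.range_cons, Fin.range_cons, hrange, ← Finset.coe_insert,
      Finset.insert_erase (Finset.mem_erase.2 ⟨hij.symm, hj⟩), ← Finset.coe_insert,
      Finset.insert_erase hi]

theorem sum_single_one_eq {ι κ : Type*} [Fintype ι] [DecidableEq κ] {o : ι → κ}
    (ho : Function.Injective o) {c : κ → ZMod 2} (hc : Set.range o = Function.support c) :
    ∑ r, Pi.single (o r) 1 = c := by
  have hone : ∀ a : ZMod 2, a ≠ 0 → a = 1 := by decide
  funext k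
  rw [Finset.sum_apply]
  by_cases hk : c k = 0
  · have hk' : k ∉ Set.range o := by rwa [hc, Function.notMem_support]
    rw [hk, Finset.sum_eq_zero fun r _ => Pi.single_eq_of_ne (fun h => hk' ⟨r, h.symm⟩) _]
  · obtain ⟨r, rfl⟩ : k ∈ Set.range o := by rwa [hc, Function.mem_support]
    rw [Finset.sum_eq_single r (fun q _ hq => Pi.single_eq_of_ne (ho.ne hq.symm) _) (by simp),
      Pi.single_eq_same, hone _ hk]

theorem exists_octad {i j : Fin 24} (hij : i ≠ j) : ∃ o : Fin 8 → Fin 24,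
    Function.Injective o ∧ o 0 = i ∧ o 1 = j ∧
      (∑ r, Pi.single (o r) 1 : Fin 24 → ZMod 2) ∈ golayCode := by
  obtain ⟨c, hc, hnorm, hi, hj⟩ := exists_mem_golayCode_hammingNorm_eq_eight i j
  obtain ⟨o, ho, h₀, h₁, hrange⟩ :=
    exists_injective_range_eq hnorm (by simpa using hi) (by simpa using hj) hij
  exact ⟨o, ho, h₀, h₁, by rwa [sum_single_one_eq ho (c := c) (hrange.trans (by ext; simp))]⟩

end Golay

section Octad

variable {E : Type*} [NormedAddCommGroup E]

/-- Four orthogonal roots of type `D` supported on the eight vectors of a scaled frame. Their eight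
signs have product one, so that a Golay octad makes half their sum a vector of the Leech lattice. -/
def octadFrame (u : Fin 8 → E) (s t : ℤ) : Fin 4 → E :=
  ![s • u 0 + t • u 1, (1 : ℤ) • u 2 + (s * t) • u 3, (1 : ℤ) • u 4 + (1 : ℤ) • u 5,
    (1 : ℤ) • u 6 + (1 : ℤ) • u 7]

/-- The signs of the vectors `u r` in `octadFrame u s t`. -/
def octadSign (s t : ℤ) : Fin 8 → ℤ := ![s, t, 1, s * t, 1, 1, 1, 1]

theorem sum_octadFrame (u : Fin 8 → E) (s t : ℤ) :
    ∑ k, octadFrame u s t k = ∑ r, octadSign s t r • u r := by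
  simp only [octadFrame, octadSign, Fin.sum_univ_four, Fin.sum_univ_eight, Matrix.cons_val]
  abel

theorem four_dvd_sum_octadSign {s t : ℤ} (hs : s ^ 2 = 1) (ht : t ^ 2 = 1) :
    4 ∣ ∑ r, octadSign s t r := by
  rcases sq_eq_one_iff.1 hs with rfl | rfl <;> rcases sq_eq_one_iff.1 ht with rfl | rfl <;>
    decide

theorem cast_octadSign {s t : ℤ} (hs : s ^ 2 = 1) (ht : t ^ 2 = 1) (r : Fin 8) :
    (octadSign s t r : ZMod 2) = 1 := by
  rcases sq_eq_one_iff.1 hs with rfl | rfl <;> rcases sq_eq_one_iff.1 ht with rfl | rfl <;>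
    decide +revert

theorem octadFrame_mem_rootLattice_dRoot {m : ℕ} (w : Fin (m + 2) → E) (o : Fin 8 → Fin (m + 2))
    {s t : ℤ} (hs : s ^ 2 = 1) (ht : t ^ 2 = 1) (k : Fin 4) :
    octadFrame (w ∘ o) s t k ∈ rootLattice (dRoot w) := by
  have hst : (s * t) ^ 2 = 1 := by rw [mul_pow, hs, ht, one_mul]
  fin_cases k
  · exact smul_add_smul_mem_rootLattice_dRoot w (o 0) (o 1) hs ht
  · exact smul_add_smul_mem_rootLattice_dRoot w (o 2) (o 3) (one_pow 2) hst
  · exact smul_add_smul_mem_rootLattice_dRoot w (o 4) (o 5) (one_pow 2) (one_pow 2)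
  · exact smul_add_smul_mem_rootLattice_dRoot w (o 6) (o 7) (one_pow 2) (one_pow 2)

variable [InnerProductSpace ℝ E]

theorem IsScaledFrame.orthonormal_octadFrame {u : Fin 8 → E} (hu : IsScaledFrame u) {s t : ℤ}
    (hs : s ^ 2 = 1) (ht : t ^ 2 = 1) : Orthonormal ℝ (octadFrame u s t) := by
  rw [orthonormal_iff_ite]
  rcases sq_eq_one_iff.1 hs with rfl | rfl <;> rcases sq_eq_one_iff.1 ht with rfl | rfl <;>
    intro p q <;> fin_cases p <;> fin_cases q <;>
    simp [octadFrame, inner_add_left, inner_add_right, hu _ _, -inner_self_eq_norm_sq_to_K] <;>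
    norm_num

/-- A permutation of the octad fixing the first pair and separating the other three: `octadFrame u`
and `octadFrame (u ∘ octadShuffle)` share only their first vector. -/
def octadShuffle : Fin 8 → Fin 8 := ![0, 1, 2, 4, 3, 6, 5, 7]

theorem bijective_octadShuffle : Function.Bijective octadShuffle := by decide

theorem IsScaledFrame.sq_inner_octadFrame_shuffle_ne_one {u : Fin 8 → E} (hu : IsScaledFrame u)
    {s t : ℤ} (hs : s ^ 2 = 1) (ht : t ^ 2 = 1) {i j : Fin 4} (hi : i ≠ 0) :
    ⟪octadFrame u s t i, octadFrame (u ∘ octadShuffle) s t j⟫ ^ 2 ≠ 1 := by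
  rcases sq_eq_one_iff.1 hs with rfl | rfl <;> rcases sq_eq_one_iff.1 ht with rfl | rfl <;>
    fin_cases i <;> fin_cases j <;> (try exact absurd rfl hi) <;>
    simp [octadFrame, octadShuffle, inner_add_left, inner_add_right, hu _ _,
      -inner_self_eq_norm_sq_to_K] <;>
    norm_num

theorem IsScaledFrame.signedRange_octadFrame_inter_subset {u : Fin 8 → E} (hu : IsScaledFrame u)
    {s t : ℤ} (hs : s ^ 2 = 1) (ht : t ^ 2 = 1) :
    signedRange (octadFrame u s t) ∩ signedRange (octadFrame (u ∘ octadShuffle) s t) ⊆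
      {s • u 0 + t • u 1, -(s • u 0 + t • u 1)} := by
  have hone (i : Fin 4) : ⟪octadFrame u s t i, octadFrame u s t i⟫ = 1 := by
    rw [real_inner_self_eq_norm_sq, (hu.orthonormal_octadFrame hs ht).1 i, one_pow]
  rintro y ⟨hy, hy'⟩
  obtain ⟨i, hi⟩ : ∃ i, y = octadFrame u s t i ∨ y = -octadFrame u s t i := by
    rcases hy with ⟨i, rfl⟩ | ⟨i, rfl⟩
    exacts [⟨i, Or.inl rfl⟩, ⟨i, Or.inr rfl⟩]
  obtain ⟨j, hj⟩ : ∃ j, octadFrame (u ∘ octadShuffle) s t j = y ∨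
      octadFrame (u ∘ octadShuffle) s t j = -y := by
    rcases hy' with ⟨j, rfl⟩ | ⟨j, rfl⟩
    exacts [⟨j, Or.inl rfl⟩, ⟨j, Or.inr (neg_neg _).symm⟩]
  have hi₀ : i = 0 := by
    by_contra h
    refine hu.sq_inner_octadFrame_shuffle_ne_one hs ht h (j := j) ?_
    rcases hi with rfl | rfl <;> rcases hj with hj | hj <;>
      simp only [hj, inner_neg_right, hone] <;> norm_num
  subst hi₀
  exact hi

end Octad

section Leech

variable {ι : Type*} [Fintype ι]

theorem hammingNorm_le_sum_sq (z : ι → ℤ) :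
    (hammingNorm (fun i => (z i : ZMod 2)) : ℤ) ≤ ∑ i, z i ^ 2 := by
  rw [hammingNorm, ← Finset.sum_boole]
  refine Finset.sum_le_sum fun i _ => ?_
  split_ifs with h
  · have hz : z i ≠ 0 := fun hz => h (by rw [hz, Int.cast_zero])
    exact Int.add_one_le_iff.2 (sq_pos_of_ne_zero hz)
  · positivity

theorem two_dvd_sum_mul_add_one (y : ι → ℤ) : 2 ∣ ∑ i, y i * (y i + 1) :=
  Finset.dvd_sum fun i _ => (Int.even_mul_succ_self (y i)).two_dvd

theorem sum_eq_neg_hammingNorm {y : ι → ℤ} (hy : ∀ i, y i * (y i + 1) = 0) :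
    ∑ i, y i = -(hammingNorm fun i => (y i : ZMod 2) : ℤ) := by
  rw [hammingNorm, ← Finset.sum_boole, ← Finset.sum_neg_distrib]
  refine Finset.sum_congr rfl fun i _ => ?_
  rcases mul_eq_zero.1 (hy i) with h | h
  · simp [h]
  · simp [eq_neg_of_add_eq_zero_left h]

theorem eight_le_sum_sq_of_even {y : ι → ℤ} (h4 : 4 ∣ ∑ i, 2 * y i) (hy : y ≠ 0) :
    8 ≤ ∑ i, (2 * y i) ^ 2 := by
  have hsq : ∑ i, (2 * y i) ^ 2 = 4 * ∑ i, y i * y i := by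
    rw [Finset.mul_sum]
    exact Finset.sum_congr rfl fun i _ => by ring
  have hpar := two_dvd_sum_mul_add_one y
  have hpos : 0 < ∑ i, y i * y i := by
    obtain ⟨i, hi⟩ := Function.ne_iff.1 hy
    exact Finset.sum_pos' (fun _ _ => mul_self_nonneg _)
      ⟨i, Finset.mem_univ i, mul_self_pos.2 hi⟩
  simp only [mul_add, mul_one, Finset.sum_add_distrib] at hpar
  rw [← Finset.mul_sum] at h4
  omega

theorem eight_le_sum_sq {z : Fin 24 → ℤ} (h4 : 4 ∣ ∑ i, z i)
    (hz : (fun i => (z i : ZMod 2)) ∈ golayCode) (hz₀ : z ≠ 0) : 8 ≤ ∑ i, z i ^ 2 := by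
  by_cases hc : (fun i => (z i : ZMod 2)) = 0
  · choose y hy using fun i => (ZMod.intCast_zmod_eq_zero_iff_dvd (z i) 2).1 (congrFun hc i)
    obtain rfl : z = fun i => 2 * y i := funext hy
    exact eight_le_sum_sq_of_even h4 fun hy₀ => hz₀ (funext fun i => by simp [hy₀])
  · exact le_trans (mod_cast eight_le_hammingNorm hz hc) (hammingNorm_le_sum_sq z)

/-- The sum is `24 + 4 ∑ y i (y i + 1)`, and the last sum is even. It vanishes only if every `y i`
is `0` or `-1`; then `∑ y i` is minus the weight of a codeword, a multiple of four. -/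
theorem thirtytwo_le_sum_sq {y : Fin 24 → ℤ} (h4 : 4 ∣ ∑ i, y i + 2)
    (hy : (fun i => (y i : ZMod 2)) ∈ golayCode) : 32 ≤ ∑ i, (2 * y i + 1) ^ 2 := by
  have hsq : ∑ i, (2 * y i + 1) ^ 2 = 24 + 4 * ∑ i, y i * (y i + 1) := by
    rw [Finset.mul_sum, show (24 : ℤ) = ∑ _i : Fin 24, 1 by simp, ← Finset.sum_add_distrib]
    exact Finset.sum_congr rfl fun i _ => by ring
  have hnonneg (i : Fin 24) : 0 ≤ y i * (y i + 1) := by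
    rcases le_or_gt 0 (y i) with h | h
    · positivity
    · exact mul_nonneg_of_nonpos_of_nonpos h.le (by omega)
  have hsum_nonneg : 0 ≤ ∑ i, y i * (y i + 1) := Finset.sum_nonneg fun i _ => hnonneg i
  have hsum_ne : ∑ i, y i * (y i + 1) ≠ 0 := fun h₀ => by
    have hsum := sum_eq_neg_hammingNorm fun i =>
      (Finset.sum_eq_zero_iff_of_nonneg fun i _ => hnonneg i).1 h₀ i (Finset.mem_univ i)
    have hweight : (4 : ℤ) ∣ hammingNorm fun i => (y i : ZMod 2) :=
      mod_cast four_dvd_hammingNorm hy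
    omega
  have hpar := two_dvd_sum_mul_add_one y
  omega

theorem two_rpow_neg_three_halves_sq : ((2 : ℝ) ^ (-(3 / 2) : ℝ)) ^ 2 = 1 / 8 := by
  rw [← Real.rpow_natCast, ← Real.rpow_mul zero_le_two,
    show (-(3 / 2) : ℝ) * (2 : ℕ) = ((-3 : ℤ) : ℝ) by norm_num, Real.rpow_intCast]
  norm_num

theorem two_rpow_neg_three_halves : (2 : ℝ) ^ (-(3 / 2) : ℝ) = 2 * (2 : ℝ) ^ (-(5 / 2) : ℝ) := by
  rw [← Real.rpow_one_add' (by norm_num) (by norm_num)]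
  norm_num

/-- The vector `2^(-3/2) z`, linear in `z`: the coordinates in which the Leech lattice is given. -/
noncomputable def leechVec : (Fin 24 → ℤ) →ₗ[ℤ] EuclideanSpace ℝ (Fin 24) where
  toFun z := WithLp.toLp 2 fun i => (2 : ℝ) ^ (-(3 / 2) : ℝ) * (z i : ℝ)
  map_add' z z' := by ext i; simp [mul_add]
  map_smul' r z := by ext i; simp; ring

theorem leechVec_apply (z : Fin 24 → ℤ) (i : Fin 24) :
    leechVec z i = (2 : ℝ) ^ (-(3 / 2) : ℝ) * (z i : ℝ) := rfl

theorem inner_leechVec (z z' : Fin 24 → ℤ) :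
    ⟪leechVec z, leechVec z'⟫ = ((z ⬝ᵥ z' : ℤ) : ℝ) / 8 := by
  rw [PiLp.inner_apply, dotProduct, Int.cast_sum, Finset.sum_div]
  refine Finset.sum_congr rfl fun i _ => ?_
  simp only [leechVec_apply, RCLike.inner_apply, conj_trivial]
  push_cast
  linear_combination (z i : ℝ) * z' i * two_rpow_neg_three_halves_sq

theorem inner_leechVec_self (z : Fin 24 → ℤ) :
    ⟪leechVec z, leechVec z⟫ = ((∑ i, z i ^ 2 : ℤ) : ℝ) / 8 := by
  simp only [inner_leechVec, dotProduct, sq]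

theorem leechVec_mem_leechLattice {z : Fin 24 → ℤ} (h4 : 4 ∣ ∑ i, z i)
    (hz : (fun i => (z i : ZMod 2)) ∈ golayCode) : leechVec z ∈ leechLattice :=
  Or.inl ⟨z, h4, ⟨_, hz, fun _ => rfl⟩, rfl⟩

/-- Doubling makes all coordinates integral: even ones on `L`, odd ones on `L + x`. -/
theorem two_smul_eq_of_mem_leechLattice {x : EuclideanSpace ℝ (Fin 24)} (hx : x ∈ leechLattice) :
    (∃ z : Fin 24 → ℤ, 4 ∣ ∑ i, z i ∧ (fun i => (z i : ZMod 2)) ∈ golayCode ∧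
      (2 : ℝ) • x = leechVec ((2 : ℤ) • z)) ∨
    ∃ y : Fin 24 → ℤ, 4 ∣ ∑ i, y i + 2 ∧ (fun i => (y i : ZMod 2)) ∈ golayCode ∧
      (2 : ℝ) • x = leechVec fun i => 2 * y i + 1 := by
  rcases hx with ⟨z, h4, ⟨c, hc, hzc⟩, rfl⟩ | ⟨_, ⟨z, h4, ⟨c, hc, hzc⟩, rfl⟩, rfl⟩
  · refine Or.inl ⟨z, h4, by rwa [show (fun i => (z i : ZMod 2)) = c from funext hzc], ?_⟩
    rw [map_smul, ← Int.cast_smul_eq_zsmul ℝ, Int.cast_ofNat]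
    rfl
  · refine Or.inr ⟨z - Pi.single 0 2, by simpa [Finset.sum_sub_distrib] using h4, ?_, ?_⟩
    · convert hc using 1
      funext i
      rw [← hzc i]
      rcases eq_or_ne i 0 with rfl | hi
      · simpa using CharP.cast_eq_zero (ZMod 2) 2
      · simp [hi]
    · ext i
      simp only [PiLp.smul_apply, PiLp.add_apply, leechShift, leechVec_apply, smul_eq_mul,
        two_rpow_neg_three_halves]
      rcases eq_or_ne i 0 with rfl | hi
      · simp
        ring
      · simp [hi]
        ring

theorem one_le_inner_self_of_mem_leechLattice {x : EuclideanSpace ℝ (Fin 24)}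
    (hx : x ∈ leechLattice) (hx₀ : x ≠ 0) : 1 ≤ ⟪x, x⟫ := by
  suffices h : 4 ≤ ⟪(2 : ℝ) • x, (2 : ℝ) • x⟫ by
    rw [real_inner_smul_left, real_inner_smul_right] at h
    linarith
  rcases two_smul_eq_of_mem_leechLattice hx with ⟨z, h4, hz, hxz⟩ | ⟨y, h4, hy, hxy⟩
  · have hz₀ : z ≠ 0 := by
      rintro rfl
      rw [smul_zero, map_zero] at hxz
      exact hx₀ ((smul_eq_zero.1 hxz).resolve_left two_ne_zero)
    have h : (8 : ℝ) ≤ (∑ i, z i ^ 2 : ℤ) := mod_cast eight_le_sum_sq h4 hz hz₀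
    rw [hxz, map_smul, ← Int.cast_smul_eq_zsmul ℝ, real_inner_smul_left, real_inner_smul_right,
      inner_leechVec_self, Int.cast_ofNat]
    linarith
  · have h : (32 : ℝ) ≤ (∑ i, (2 * y i + 1) ^ 2 : ℤ) := mod_cast thirtytwo_le_sum_sq h4 hy
    rw [hxy, inner_leechVec_self]
    linarith

theorem finite_unitVectors_leechLattice : (unitVectors leechLattice).Finite := by
  have hfin : (Set.pi Set.univ fun _ : Fin 24 => Set.Icc (-6 : ℤ) 6).Finite :=
    Set.Finite.pi fun _ => Set.finite_Icc _ _
  refine (hfin.image fun k => (1 / 2 : ℝ) • leechVec k).subset fun x hx => ?_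
  obtain ⟨k, hk⟩ : ∃ k, (2 : ℝ) • x = leechVec k := by
    rcases two_smul_eq_of_mem_leechLattice hx.1 with ⟨z, -, -, h⟩ | ⟨y, -, -, h⟩
    exacts [⟨_, h⟩, ⟨_, h⟩]
  have hsum : ∑ i, k i ^ 2 = 32 := by
    have h := inner_leechVec_self k
    rw [← hk, real_inner_smul_left, real_inner_smul_right, (mem_unitVectors_iff.1 hx).2] at h
    rify
    push_cast at h
    linarith
  refine ⟨k, fun i _ => abs_le.1 ?_, ?_⟩
  · have hle : k i ^ 2 ≤ 32 := hsum ▸ Finset.single_le_sum (f := fun i => k i ^ 2)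
      (fun _ _ => sq_nonneg _) (Finset.mem_univ i)
    by_contra! hlt
    nlinarith [sq_abs (k i)]
  · simp only [← hk, smul_smul]
    norm_num

/-- The scaled frame of vectors `2^(-1/2) eᵢ`, whose root system of type `D` lies in the Leech
lattice. -/
noncomputable def leechFrame (i : Fin 24) : EuclideanSpace ℝ (Fin 24) :=
  (2 : ℤ) • leechVec (Pi.single i 1)

theorem isScaledFrame_leechFrame : IsScaledFrame leechFrame := fun i j => by
  simp only [leechFrame, ← map_smul, inner_leechVec, smul_dotProduct, dotProduct_smul,
    single_one_dotProduct, Pi.single_apply]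
  split_ifs <;> norm_num

theorem span_leechFrame : Submodule.span ℝ (Set.range leechFrame) = ⊤ :=
  isScaledFrame_leechFrame.linearIndependent.span_eq_top_of_card_eq_finrank' (by simp)

theorem smul_leechFrame_add_smul_mem_leechLattice (i j : Fin 24) {s t : ℤ}
    (hst : 2 ∣ s + t) : s • leechFrame i + t • leechFrame j ∈ leechLattice := by
  rw [leechFrame, leechFrame, ← map_smul, ← map_smul, ← map_smul, ← map_smul, ← map_add]
  refine leechVec_mem_leechLattice ?_ ?_
  · simp only [Pi.add_apply, Pi.smul_apply, smul_eq_mul, Finset.sum_add_distrib, ← Finset.mul_sum,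
      Finset.sum_pi_single', Finset.mem_univ, if_true]
    omega
  · convert golayCode.zero_mem using 1
    funext k
    have htwo : (2 : ZMod 2) = 0 := CharP.cast_eq_zero (ZMod 2) 2
    simp [htwo]

theorem rootLattice_dRoot_leechFrame_le : rootLattice (dRoot (m := 22) leechFrame) ≤
    leechLattice := by
  refine Submodule.span_le.2 ?_
  rintro _ ⟨i, rfl⟩
  induction i using Fin.lastCases with
  | last =>
    rw [dRoot_last]
    simpa using smul_leechFrame_add_smul_mem_leechLattice _ _ (s := 1) (t := 1) (by norm_num)
  | cast i =>
    rw [dRoot_castSucc]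
    simpa [sub_eq_add_neg] using
      smul_leechFrame_add_smul_mem_leechLattice _ _ (s := 1) (t := -1) (by norm_num)

theorem half_smul_sum_octadFrame (o : Fin 8 → Fin 24) (s t : ℤ) :
    (1 / 2 : ℝ) • ∑ k, octadFrame (leechFrame ∘ o) s t k =
      leechVec (∑ r, octadSign s t r • Pi.single (o r) 1) := by
  rw [sum_octadFrame, map_sum, Finset.smul_sum]
  refine Finset.sum_congr rfl fun r _ => ?_
  simp only [Function.comp_apply, leechFrame, map_smul, ← Int.cast_smul_eq_zsmul ℝ]
  push_cast
  module

section HalvedFrame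

variable {o : Fin 8 → Fin 24} {s t : ℤ} (hs : s ^ 2 = 1) (ht : t ^ 2 = 1)
  (hcode : (∑ r, Pi.single (o r) 1 : Fin 24 → ZMod 2) ∈ golayCode)
include hs ht hcode

theorem half_smul_sum_octadFrame_mem_leechLattice :
    (1 / 2 : ℝ) • ∑ k, octadFrame (leechFrame ∘ o) s t k ∈ leechLattice := by
  rw [half_smul_sum_octadFrame]
  refine leechVec_mem_leechLattice ?_ ?_
  · simp only [Finset.sum_apply, Pi.smul_apply, smul_eq_mul]
    rw [Finset.sum_comm]
    simpa [← Finset.mul_sum] using four_dvd_sum_octadSign hs ht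
  · convert hcode using 1
    funext k
    simp only [Finset.sum_apply, Pi.smul_apply, smul_eq_mul, Int.cast_sum, Int.cast_mul,
      cast_octadSign hs ht, one_mul, Pi.single_apply, Int.cast_ite, Int.cast_one, Int.cast_zero]

variable (ho : Function.Injective o)
include ho

theorem isHalvedFrame_octadFrame :
    IsHalvedFrame (rootLattice (dRoot (m := 22) leechFrame)) leechLattice
      (octadFrame (leechFrame ∘ o) s t) where
  orthonormal := (isScaledFrame_leechFrame.comp ho).orthonormal_octadFrame hs ht
  mem := octadFrame_mem_rootLattice_dRoot leechFrame o hs ht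
  half_sum_mem := half_smul_sum_octadFrame_mem_leechLattice hs ht hcode

theorem hasFramePair_octad :
    HasFramePair (rootLattice (dRoot (m := 22) leechFrame)) leechLattice
      (s • leechFrame (o 0) + t • leechFrame (o 1)) := by
  have hcode_shuffle :
      (∑ r, Pi.single ((o ∘ octadShuffle) r) 1 : Fin 24 → ZMod 2) ∈ golayCode := by
    rwa [← bijective_octadShuffle.sum_comp fun r => (Pi.single (o r) 1 : Fin 24 → ZMod 2)] at hcode
  exact ⟨octadFrame (leechFrame ∘ o) s t, octadFrame (leechFrame ∘ o ∘ octadShuffle) s t,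
    isHalvedFrame_octadFrame hs ht hcode ho,
    isHalvedFrame_octadFrame hs ht hcode_shuffle (ho.comp bijective_octadShuffle.injective),
    rfl, rfl, (isScaledFrame_leechFrame.comp ho).signedRange_octadFrame_inter_subset hs ht⟩

end HalvedFrame

theorem isRedundantlyExtreme_leechLattice :
    IsRedundantlyExtreme (minimalConfiguration leechLattice) := by
  have hw := isScaledFrame_leechFrame
  have hle := rootLattice_dRoot_leechFrame_le
  have hsub : unitVectors (rootLattice (dRoot (m := 22) leechFrame)) ⊆ unitVectors leechLattice :=
    fun x hx => ⟨hle hx.1, hx.2⟩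
  have hconf := isConfiguration_unitVectors finite_unitVectors_leechLattice
  have hD : IsExtreme (unitVectors (rootLattice (dRoot (m := 22) leechFrame))) :=
    hw.isSimpleSystem_dRoot.isExtreme ((span_dRoot (m := 22) _).trans span_leechFrame)
      (isConnectedCartan_D (by norm_num))
  have hne : (unitVectors leechLattice).Nonempty :=
    ⟨_, hsub (hw.mem_unitVectors_rootLattice_dRoot_iff.2
      ⟨0, 1, by decide, 1, 1, one_pow 2, one_pow 2, rfl⟩)⟩
  rw [minimalConfiguration_eq_unitVectors hne fun x => one_le_inner_self_of_mem_leechLattice]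
  refine ⟨hD.mono hconf hsub, fun x hx => ?_⟩
  by_cases hxD : x ∈ unitVectors (rootLattice (dRoot (m := 22) leechFrame))
  · obtain ⟨i, j, hij, s, t, hs, ht, rfl⟩ := hw.mem_unitVectors_rootLattice_dRoot_iff.1 hxD
    obtain ⟨o, ho, rfl, rfl, hcode⟩ := exists_octad hij
    exact (hasFramePair_octad hs ht hcode ho).isExtreme_diff hle
      hw.isSimpleSystem_dRoot.isHalfIntegral hD.1 finite_unitVectors_leechLattice
  · refine hD.mono (hconf.diff_pair x) fun y hy => ⟨hsub hy, ?_⟩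
    rintro (rfl | rfl)
    · exact hxD hy
    · exact hxD (neg_neg x ▸ neg_mem_unitVectors hy)

end Leech

end PerfectEutactic

theorem mainTheorem8 :
    (∀ n : ℕ, 2 ≤ n →
      (∃ Λ, IsRootLattice (CartanMatrix.A n) Λ) ∧
      ∀ Λ, IsRootLattice (CartanMatrix.A n) Λ → IsMinimallyExtreme (minimalConfiguration Λ)) ∧
    (∀ n : ℕ, 4 ≤ n →
      (∃ Λ, IsRootLattice (CartanMatrix.D n) Λ) ∧
      ∀ Λ, IsRootLattice (CartanMatrix.D n) Λ →
        IsRedundantlySemiEutactic (minimalConfiguration Λ) ∧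
        ¬ IsRedundantlyExtreme (minimalConfiguration Λ)) ∧
    ((∃ Λ, IsRootLattice CartanMatrix.E₆ Λ) ∧
      ∀ Λ, IsRootLattice CartanMatrix.E₆ Λ → IsRedundantlyExtreme (minimalConfiguration Λ)) ∧
    ((∃ Λ, IsRootLattice CartanMatrix.E₇ Λ) ∧
      ∀ Λ, IsRootLattice CartanMatrix.E₇ Λ → IsRedundantlyExtreme (minimalConfiguration Λ)) ∧
    ((∃ Λ, IsRootLattice CartanMatrix.E₈ Λ) ∧
      ∀ Λ, IsRootLattice CartanMatrix.E₈ Λ → IsRedundantlyExtreme (minimalConfiguration Λ)) ∧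
    IsRedundantlyExtreme (minimalConfiguration leechLattice) :=
  ⟨fun n hn =>
      have : NeZero n := ⟨by omega⟩
      ⟨exists_isRootLattice_A n, fun _ hΛ => hΛ.isMinimallyExtreme⟩,
    fun n hn =>
      ⟨exists_isRootLattice_D (by omega), fun _ hΛ =>
        ⟨hΛ.isRedundantlySemiEutactic hn, hΛ.not_isRedundantlyExtreme (by omega)⟩⟩,
    ⟨exists_isSimpleSystem_E₆.elim fun _ hv => hv.exists_isRootLattice,
      fun _ => isRedundantlyExtreme_E₆⟩,
    ⟨exists_isSimpleSystem_E₇.elim fun _ hv => hv.exists_isRootLattice,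
      fun _ => isRedundantlyExtreme_E₇⟩,
    ⟨exists_isSimpleSystem_E₈.elim fun _ hv => hv.exists_isRootLattice,
      fun _ => isRedundantlyExtreme_E₈⟩,
    isRedundantlyExtreme_leechLattice⟩
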